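/- Let $\rho:\mathbb R\to\mathbb R$ be even and integrable with $|\rho(\lambda)|\le U$ for all $\lambda$, where $U>0$, let $\mu\in(-1/U,1/U)$, and put $h(x)=\frac1{2\pi}\int_{-\infty}^{\infty}e^{ix\lambda}\rho(\lambda)\,d\lambda$. Consider the bounded, positive definite, invertible operators $$Sf=f(x)-\mu\int_0^\infty h(x-t)f(t)\,dt\ \text{ on } L^2(0,\infty),\qquad S_\xi f=f(x)-\mu\int_0^\xi h(x-t)f(t)\,dt\ \text{ on } L^2(0,\xi),\ 0<\xi<\infty .$$ Let $R_\xi(x,t)$ be the continuous kernel on $[0,\xi]^2$ with $S_\xi^{-1}f=f(x)+\int_0^\xi R_\xi(x,t)f(t)\,dt$, and put $$M(x)=\tfrac12-\mu\int_0^x h(s)\,ds,\quad q_1(x)=1+\int_0^x R_x(x,t)\,dt,\quad q_2(x)=M(x)+\int_0^x M(t)R_x(x,t)\,dt .$$ Let $W(x,z)$ ($x\ge 0$, $z\in\mathbb C$) be the $2\times2$ matrix solution of $$\frac{dW}{dx}=izJH(x)W,\quad W(0,z)=I_2,\qquad H(x)=\begin{bmatrix}q_2^2(x)&1/2\\1/2&q_1^2(x)\end{bmatrix},\quad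 J=\begin{bmatrix}0&1\\1&0\end{bmatrix},$$ and let $w_{1,2}(x,z)$ be its entry in row $1$, column $2$. Assume that $\int_0^\infty h(x)\,dx=\frac12$ and that $x\mapsto\int_x^\infty h(t)\,dt$ belongs to $L^2(0,\infty)$ (improper integrals). Put $q(x)=M(x)-\frac{1-\mu}2$, $r=S^{-1}q\in L^2(0,\infty)$ and $$G(z)=\frac1{1-\mu}\Big[1-iz\int_0^\infty e^{-izx}r(x)\,dx\Big],\qquad \operatorname{Im}z<0 .$$ **Proposition 3.1.** If at least one of the two relations $$\lim_{\xi\to\infty}e^{-iz\xi}w_{1,2}(\xi,z)=G(z)\quad(\text{for all } z \text{ with } \operatorname{Im}z<0),\qquad \lim_{\xi\to\infty}w_{1,2}(\xi,z)=-\overline{G(\overline z)}\quad(\text{for all } z \text{ with } \operatorname{Im}z>0)$$ is not true, then $S$ admits no (left) triangular factorization. That is, $S$ cannot be written as $S=S_-S_-^*$ with $S_-$ and $S_-^{-1}$ bounded on $L^2(0,\infty)$ and lower triangular, where $T$ is lower triangular if $TQ_\xi=Q_\xi TQ_\xi$ for every $\xi$, with $Q_\xi f=f$ on $(\xi,\infty)$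 and $Q_\xi f=0$ on $(0,\xi)$. -/

import Mathlib

open MeasureTheory Set Filter Topology
open scoped FourierTransform InnerProductSpace ContDiff

namespace WienerHopf

/-! ### The operators `S` and `S_ξ` -/

/-- The kernel `h(x) = (1 / 2π) ∫ e^{i x l} ρ(l) dl` of the convolution operators. -/
noncomputable def kernel (ρ : ℝ → ℝ) (x : ℝ) : ℂ :=
  1 / (2 * (Real.pi : ℂ)) * ∫ l : ℝ, Complex.exp (Complex.I * x * l) * (ρ l : ℂ)

/-- The complex Hilbert space `L²(A)` for `A ⊆ ℝ` with Lebesgue measure. -/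
abbrev L2 (A : Set ℝ) : Type := Lp ℂ 2 (volume.restrict A)

theorem kernel_eq_fourierInv (ρ : ℝ → ℝ) (x : ℝ) :
    kernel ρ x = 𝓕⁻ (fun s : ℝ => (ρ (2 * Real.pi * s) : ℂ)) x := by
  have hpi : (0 : ℝ) < 2 * Real.pi := by positivity
  rw [Real.fourierInv_eq', kernel]
  have := Measure.integral_comp_mul_left
    (fun l : ℝ => Complex.exp (Complex.I * x * l) * (ρ l : ℂ)) (2 * Real.pi)
  rw [abs_of_pos (inv_pos.2 hpi)] at this
  have h2 : (1 / (2 * (Real.pi : ℂ))) = (((2 * Real.pi)⁻¹ : ℝ) : ℂ) := by push_cast; simp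
  rw [h2, ← Complex.real_smul, ← this]
  refine integral_congr_ae (ae_of_all _ fun s => ?_)
  simp only [smul_eq_mul]
  congr 2
  simp
  ring

theorem continuous_fourierInv {f : ℝ → ℂ} (hf : Integrable f) : Continuous (𝓕⁻ f) := by
  rw [← Real.Lp.fourierTransformInv_toLp (memLp_one_iff_integrable.2 hf)]
  exact (Real.Lp.fourierTransformInv _).continuous

theorem fourierInv_toLp_ae {f : ℝ → ℂ} (hf : Integrable f) (hf2 : MemLp f 2) :
    ((𝓕⁻ (hf2.toLp f) : Lp ℂ 2 (volume : Measure ℝ)) : ℝ → ℂ) =ᵐ[volume] 𝓕⁻ f := by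
  refine ae_eq_of_integral_contDiff_smul_eq ((Lp.memLp _).locallyIntegrable (by norm_num))
    (continuous_fourierInv hf).locallyIntegrable fun g hg hgs => ?_
  have hg₁ : HasCompactSupport (Complex.ofRealCLM ∘ g) := hgs.comp_left rfl
  have hg₂ : ContDiff ℝ ∞ (Complex.ofRealCLM ∘ g) := by fun_prop
  set G := hg₁.toSchwartzMap hg₂ with hG
  have hGg : ∀ x, G x = (g x : ℂ) := fun x => rfl
  have h := congrArg (fun T => T G) (Lp.fourierInv_toTemperedDistribution_eq (hf2.toLp f))
  simp only [TemperedDistribution.fourierInv_apply, Lp.toTemperedDistribution_apply] at h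
  have e1 : ∫ x, g x • ((𝓕⁻ (hf2.toLp f) : Lp ℂ 2 (volume : Measure ℝ)) : ℝ → ℂ) x =
      ∫ x, G x • ((𝓕⁻ (hf2.toLp f) : Lp ℂ 2 (volume : Measure ℝ)) : ℝ → ℂ) x := by
    simp [hGg]
  rw [e1, ← h]
  have e2 : ∫ x, (𝓕⁻ G) x • (hf2.toLp f : ℝ → ℂ) x = ∫ x, (𝓕⁻ (G : ℝ → ℂ)) x • f x := by
    refine integral_congr_ae ?_
    filter_upwards [hf2.coeFn_toLp] with x hx
    rw [hx, SchwartzMap.fourierInv_coe]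
  rw [e2]
  have e3 := VectorFourier.integral_fourierIntegral_smul_eq_flip (e := Real.fourierChar)
    (μ := (volume : Measure ℝ)) (ν := (volume : Measure ℝ)) (L := -(innerₗ ℝ))
    (f := (G : ℝ → ℂ)) (g := f) Real.continuous_fourierChar (by
      simp only [LinearMap.neg_apply]; exact continuous_inner.neg) G.integrable hf
  have hflip : (-(innerₗ ℝ) : ℝ →ₗ[ℝ] ℝ →ₗ[ℝ] ℝ).flip = -(innerₗ ℝ) := by
    ext; simp
  rw [hflip] at e3
  have e4 : ∫ x, g x • (𝓕⁻ f) x = ∫ x, G x • (𝓕⁻ f) x := by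
    simp [hGg]
  rw [e4]
  exact e3

/-- Convolution of `L²` functions with the kernel is a Fourier multiplier. -/
theorem conv_ae {ρ : ℝ → ℝ} {U : ℝ} (hb : ∀ l, |ρ l| ≤ U) (hi : Integrable ρ)
    (F : Lp ℂ 2 (volume : Measure ℝ)) :
    MemLp (fun x => ∫ t, kernel ρ (x - t) * F t) 2 volume ∧
    eLpNorm (fun x => ∫ t, kernel ρ (x - t) * F t) 2 volume ≤ ENNReal.ofReal (U * ‖F‖) := by
  have hU : 0 ≤ U := (abs_nonneg _).trans (hb 0)
  set σ : ℝ → ℂ := fun s => (ρ (2 * Real.pi * s) : ℂ) with hσ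
  have hσi : Integrable σ := (hi.comp_mul_left' (by positivity)).ofReal
  have hσb : ∀ s, ‖σ s‖ ≤ U := fun s => by simpa [hσ] using hb _
  have hσ2 : MemLp σ 2 := by
    rw [memLp_two_iff_integrable_sq_norm hσi.1]
    refine (hσi.norm.const_mul U).mono' (hσi.1.norm.pow 2) (ae_of_all _ fun s => ?_)
    rw [Real.norm_of_nonneg (by positivity), sq]
    exact mul_le_mul_of_nonneg_right (hσb s) (norm_nonneg _)
  set Φ : Lp ℂ 2 (volume : Measure ℝ) := 𝓕 F with hΦ
  have hΦn : ‖Φ‖ = ‖F‖ := Lp.norm_fourier_eq F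
  have hpi : Integrable (fun s => σ s * Φ s) := hσ2.integrable_mul (Lp.memLp Φ)
  have hp2 : MemLp (fun s => σ s * Φ s) 2 :=
    (Lp.memLp Φ).of_le_mul hpi.1 (c := U) (ae_of_all _ fun s => by
      rw [norm_mul]; exact mul_le_mul_of_nonneg_right (hσb s) (norm_nonneg _))
  have key : (fun x => ∫ t, kernel ρ (x - t) * F t) = 𝓕⁻ (fun s => σ s * Φ s) := by
    funext x
    set σx : ℝ → ℂ := fun s => Complex.exp (((-(2 * Real.pi * (s * x)) : ℝ) : ℂ) * Complex.I) * σ s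
      with hσx
    have hn : ∀ s, ‖σx s‖ = ‖σ s‖ := fun s => by
      simp only [hσx, norm_mul, Complex.norm_exp_ofReal_mul_I, one_mul]
    have hσxm : AEStronglyMeasurable σx volume :=
      AEStronglyMeasurable.mul (by fun_prop) hσi.1
    have hσxi : Integrable σx := hσi.mono hσxm (ae_of_all _ fun s => (hn s).le)
    have hσx2 : MemLp σx 2 := hσ2.mono hσxm (ae_of_all _ fun s => (hn s).le)
    have hcoe := fourierInv_toLp_ae hσxi hσx2
    have hin := Lp.inner_fourier_eq (𝓕⁻ (hσx2.toLp σx) : Lp ℂ 2 (volume : Measure ℝ)) F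
    rw [FourierTransform.fourier_fourierInv_eq, L2.inner_def, L2.inner_def] at hin
    have hk : ∀ t, (starRingEnd ℂ) (𝓕⁻ σx t) = kernel ρ (x - t) := by
      intro t
      rw [kernel_eq_fourierInv, Real.fourierInv_eq', Real.fourierInv_eq', ← integral_conj]
      refine integral_congr_ae (ae_of_all _ fun s => ?_)
      simp only [hσx, hσ, smul_eq_mul, map_mul, ← Complex.exp_conj, Complex.conj_ofReal,
        ← mul_assoc, ← Complex.exp_add]
      congr 2
      have h2 : (starRingEnd ℂ) (2 : ℂ) = 2 := map_ofNat _ 2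
      simp [h2]
      ring
    have e1 : ∫ t, kernel ρ (x - t) * F t =
        ∫ t, ⟪((𝓕⁻ (hσx2.toLp σx) : Lp ℂ 2 (volume : Measure ℝ)) : ℝ → ℂ) t, F t⟫_ℂ := by
      refine integral_congr_ae ?_
      filter_upwards [hcoe] with t ht
      rw [ht, ← hk, RCLike.inner_apply, mul_comm]
    rw [e1, ← hin, Real.fourierInv_eq']
    refine integral_congr_ae ?_
    filter_upwards [hσx2.coeFn_toLp] with s hs
    rw [hs, RCLike.inner_apply, mul_comm]
    simp only [hσx, hσ, smul_eq_mul, map_mul, ← Complex.exp_conj, Complex.conj_ofReal,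
        Complex.conj_I, ← mul_assoc]
    congr 3
    simp
    ring
  have hae := fourierInv_toLp_ae hpi hp2
  rw [key]
  refine ⟨(memLp_congr_ae hae).1 (Lp.memLp _), ?_⟩
  rw [← eLpNorm_congr_ae hae, ← Lp.enorm_def, ← ofReal_norm]
  refine ENNReal.ofReal_le_ofReal ?_
  have h1 : ‖(𝓕⁻ (hp2.toLp _) : Lp ℂ 2 (volume : Measure ℝ))‖ = ‖hp2.toLp _‖ :=
    (Lp.fourierTransformₗᵢ ℝ ℂ).symm.norm_map _
  rw [h1, ← hΦn]
  refine Lp.norm_le_mul_norm_of_ae_le_mul ?_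
  filter_upwards [hp2.coeFn_toLp] with s hs
  rw [hs, norm_mul]
  exact mul_le_mul_of_nonneg_right (hσb s) (norm_nonneg _)

theorem continuous_kernel {ρ : ℝ → ℝ} (hi : Integrable ρ) : Continuous (kernel ρ) := by
  rw [funext (kernel_eq_fourierInv ρ)]
  exact continuous_fourierInv (hi.comp_mul_left' (by positivity)).ofReal

/-- `T` is the bounded operator `(T f)(x) = ∫_A h(x - t) f(t) dt` on `L²(A)`. -/
def IsConvolutionOperator (ρ : ℝ → ℝ) (A : Set ℝ) (T : L2 A →L[ℂ] L2 A) : Prop :=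
  ∀ f : L2 A, T f =ᵐ[volume.restrict A] fun x => ∫ t in A, kernel ρ (x - t) * f t

theorem integrable_kernel_mul {ρ : ℝ → ℝ} {U : ℝ} (hb : ∀ l, |ρ l| ≤ U) (hi : Integrable ρ)
    {A : Set ℝ} (f : L2 A) (x : ℝ) :
    Integrable (fun t => kernel ρ (x - t) * f t) (volume.restrict A) := by
  have hU : 0 ≤ U := (abs_nonneg _).trans (hb 0)
  have hσi : Integrable (fun s => (ρ (2 * Real.pi * s) : ℂ)) :=
    (hi.comp_mul_left' (by positivity)).ofReal
  have hσ2 : MemLp (fun s => (ρ (2 * Real.pi * s) : ℂ)) 2 := by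
    rw [memLp_two_iff_integrable_sq_norm hσi.1]
    refine (hσi.norm.const_mul U).mono' (hσi.1.norm.pow 2) (ae_of_all _ fun s => ?_)
    rw [Real.norm_of_nonneg (by positivity), sq]
    exact mul_le_mul_of_nonneg_right (by simpa using hb _) (norm_nonneg _)
  have hk : MemLp (kernel ρ) 2 := by
    rw [funext (kernel_eq_fourierInv ρ)]
    exact (memLp_congr_ae (fourierInv_toLp_ae hσi hσ2)).1 (Lp.memLp _)
  have hk2 : MemLp (fun t => kernel ρ (x - t)) 2 :=
    hk.comp_measurePreserving (Measure.measurePreserving_sub_left volume x)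
  exact (hk2.restrict A).integrable_mul (Lp.memLp f)

theorem conv_restrict {ρ : ℝ → ℝ} {U : ℝ} (hb : ∀ l, |ρ l| ≤ U) (hi : Integrable ρ)
    {A : Set ℝ} (hA : MeasurableSet A) (f : L2 A) :
    MemLp (fun x => ∫ t in A, kernel ρ (x - t) * f t) 2 (volume.restrict A) ∧
    eLpNorm (fun x => ∫ t in A, kernel ρ (x - t) * f t) 2 (volume.restrict A) ≤
      ENNReal.ofReal (U * ‖f‖) := by
  have hm : MemLp (A.indicator f) 2 volume :=
    (memLp_indicator_iff_restrict hA).2 (Lp.memLp f)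
  have hn : ‖hm.toLp _‖ = ‖f‖ := by
    rw [Lp.norm_toLp, eLpNorm_indicator_eq_eLpNorm_restrict hA, Lp.norm_def]
  have he : (fun x => ∫ t, kernel ρ (x - t) * hm.toLp _ t) =
      fun x => ∫ t in A, kernel ρ (x - t) * f t := by
    funext x
    rw [← integral_indicator hA]
    refine integral_congr_ae ?_
    filter_upwards [hm.coeFn_toLp] with t ht
    rw [ht]
    by_cases h : t ∈ A <;> simp [h]
  have := conv_ae hb hi (hm.toLp _)
  rw [he, hn] at this
  exact ⟨this.1.restrict A, (eLpNorm_mono_measure _ Measure.restrict_le_self).trans this.2⟩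

theorem exists_convolutionOperator {ρ : ℝ → ℝ} {U : ℝ} (hb : ∀ l, |ρ l| ≤ U) (hi : Integrable ρ)
    {A : Set ℝ} (hA : MeasurableSet A) :
    ∃ T : L2 A →L[ℂ] L2 A, IsConvolutionOperator ρ A T ∧ ‖T‖ ≤ U := by
  have hU : 0 ≤ U := (abs_nonneg _).trans (hb 0)
  have hM := fun f : L2 A => conv_restrict hb hi hA f
  let T0 : L2 A →ₗ[ℂ] L2 A :=
    { toFun := fun f => (hM f).1.toLp _
      map_add' := fun f g => by
        rw [← MemLp.toLp_add]
        refine MemLp.toLp_congr _ _ (ae_of_all _ fun x => ?_)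
        simp only [Pi.add_apply]
        rw [← integral_add (integrable_kernel_mul hb hi f x) (integrable_kernel_mul hb hi g x)]
        refine integral_congr_ae ?_
        filter_upwards [Lp.coeFn_add f g] with t ht
        rw [ht, Pi.add_apply, mul_add]
      map_smul' := fun c f => by
        rw [RingHom.id_apply, ← MemLp.toLp_const_smul]
        refine MemLp.toLp_congr _ _ (ae_of_all _ fun x => ?_)
        simp only [Pi.smul_apply]
        rw [← integral_smul]
        refine integral_congr_ae ?_
        filter_upwards [Lp.coeFn_smul c f] with t ht
        rw [ht, Pi.smul_apply, mul_smul_comm] }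
  have hT0 : ∀ f, ‖T0 f‖ ≤ U * ‖f‖ := fun f => by
    change ‖(hM f).1.toLp _‖ ≤ _
    rw [Lp.norm_toLp]
    exact ENNReal.toReal_le_of_le_ofReal (by positivity) (hM f).2
  refine ⟨T0.mkContinuous U hT0, fun f => (hM f).1.coeFn_toLp, ?_⟩
  exact T0.mkContinuous_norm_le hU hT0

theorem IsConvolutionOperator.unique {ρ : ℝ → ℝ} {A : Set ℝ} {T T' : L2 A →L[ℂ] L2 A}
    (h : IsConvolutionOperator ρ A T) (h' : IsConvolutionOperator ρ A T') : T = T' :=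
  ContinuousLinearMap.ext fun f => Lp.ext ((h f).trans (h' f).symm)

open Classical in
/-- The bounded operator `H f = ∫_A h(x - t) f(t) dt` on `L²(A)`. It exists (and is unique) as soon
as `ρ` is bounded and integrable, see `convolutionOperator_spec`. -/
noncomputable def convolutionOperator (ρ : ℝ → ℝ) (A : Set ℝ) : L2 A →L[ℂ] L2 A :=
  if h : ∃ T, IsConvolutionOperator ρ A T then h.choose else 0

theorem convolutionOperator_spec {ρ : ℝ → ℝ} {U : ℝ} (hb : ∀ l, |ρ l| ≤ U) (hi : Integrable ρ)
    {A : Set ℝ} (hA : MeasurableSet A) :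
    IsConvolutionOperator ρ A (convolutionOperator ρ A) ∧ ‖convolutionOperator ρ A‖ ≤ U := by
  obtain ⟨T, hT, hTn⟩ := exists_convolutionOperator hb hi hA
  have h : ∃ T, IsConvolutionOperator ρ A T := ⟨T, hT⟩
  have hs : IsConvolutionOperator ρ A (convolutionOperator ρ A) := by
    rw [convolutionOperator, dif_pos h]; exact h.choose_spec
  exact ⟨hs, by rwa [hs.unique hT]⟩

/-- The operator `f ↦ f(x) - μ ∫_A h(x - t) f(t) dt` on `L²(A)`. -/
noncomputable def opS (ρ : ℝ → ℝ) (μ : ℝ) (A : Set ℝ) : L2 A →L[ℂ] L2 A :=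
  1 - (μ : ℂ) • convolutionOperator ρ A

/-- The operator `S f = f(x) - μ ∫_0^∞ h(x - t) f(t) dt` on `L²(0,∞)`. -/
noncomputable abbrev fullS (ρ : ℝ → ℝ) (μ : ℝ) : L2 (Ioi 0) →L[ℂ] L2 (Ioi 0) :=
  opS ρ μ (Ioi 0)

/-- The operator `S_ξ f = f(x) - μ ∫_0^ξ h(x - t) f(t) dt` on `L²(0,ξ)`. -/
noncomputable abbrev truncS (ρ : ℝ → ℝ) (μ ξ : ℝ) : L2 (Ioo 0 ξ) →L[ℂ] L2 (Ioo 0 ξ) :=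
  opS ρ μ (Ioo 0 ξ)

theorem isInvertible_opS {ρ : ℝ → ℝ} {U μ : ℝ} (hb : ∀ l, |ρ l| ≤ U) (hi : Integrable ρ)
    (hμ : |μ| * U < 1) {A : Set ℝ} (hA : MeasurableSet A) : (opS ρ μ A).IsInvertible := by
  have h : ‖(μ : ℂ) • convolutionOperator ρ A‖ < 1 := by
    refine lt_of_le_of_lt (norm_smul_le (μ : ℂ) (convolutionOperator ρ A)) ?_
    rw [Complex.norm_real]
    exact lt_of_le_of_lt (mul_le_mul_of_nonneg_left (convolutionOperator_spec hb hi hA).2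
      (abs_nonneg μ)) hμ
  obtain ⟨u, hu⟩ := isUnit_one_sub_of_norm_lt_one h
  refine ContinuousLinearMap.IsInvertible.of_inverse (g := (↑u⁻¹ : L2 A →L[ℂ] L2 A)) ?_ ?_
  · rw [opS, ← hu]; exact u.mul_inv
  · rw [opS, ← hu]; exact u.inv_mul

/-! ### The resolvent kernel -/

/-- `K` is the continuous kernel on `[0,ξ]²` with `S_ξ⁻¹ f = f(x) + ∫_0^ξ K(x,t) f(t) dt`. -/
def IsResolventKernel (ρ : ℝ → ℝ) (μ ξ : ℝ) (K : ℝ → ℝ → ℂ) : Prop :=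
  ContinuousOn (Function.uncurry K) (Icc 0 ξ ×ˢ Icc 0 ξ) ∧
  ∀ f : L2 (Ioo 0 ξ), (truncS ρ μ ξ).inverse f =ᵐ[volume.restrict (Ioo 0 ξ)]
    fun x => f x + ∫ t in Ioo 0 ξ, K x t * f t

theorem conj_kernel (ρ : ℝ → ℝ) (x : ℝ) : (starRingEnd ℂ) (kernel ρ x) = kernel ρ (-x) := by
  have h2 : (starRingEnd ℂ) (2 : ℂ) = 2 := map_ofNat _ 2
  rw [kernel, kernel, map_mul, ← integral_conj]
  congr 1
  · simp [h2]
  · refine integral_congr_ae (ae_of_all _ fun l => ?_)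
    simp [← Complex.exp_conj]

theorem norm_kernel_le (ρ : ℝ → ℝ) : ∃ C, 0 ≤ C ∧ ∀ x, ‖kernel ρ x‖ ≤ C := by
  refine ⟨‖1 / (2 * (Real.pi : ℂ))‖ * ∫ l, ‖(ρ l : ℂ)‖, by positivity, fun x => ?_⟩
  rw [kernel, norm_mul]
  refine mul_le_mul_of_nonneg_left ((norm_integral_le_integral_norm _).trans (le_of_eq ?_))
    (norm_nonneg _)
  refine integral_congr_ae (ae_of_all _ fun l => ?_)
  have : Complex.I * x * l = ((x * l : ℝ) : ℂ) * Complex.I := by push_cast; ring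
  simp only [norm_mul, this, Complex.norm_exp_ofReal_mul_I, one_mul]

theorem exists_isResolventKernel {ρ : ℝ → ℝ} {U μ : ℝ} (hb : ∀ l, |ρ l| ≤ U) (hi : Integrable ρ)
    (hμ : |μ| * U < 1) (ξ : ℝ) : ∃ K, IsResolventKernel ρ μ ξ K := by
  set A : Set ℝ := Ioo 0 ξ with hA
  have hAm : MeasurableSet A := measurableSet_Ioo
  have : IsFiniteMeasure (volume.restrict A) := ⟨by simp [hA]⟩
  set H := convolutionOperator ρ A with hH
  have hHs : IsConvolutionOperator ρ A H := (convolutionOperator_spec hb hi hAm).1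
  have hinv : (opS ρ μ A).IsInvertible := isInvertible_opS hb hi hμ hAm
  set N := (opS ρ μ A).inverse with hN
  have hkc := continuous_kernel hi
  have hkt : Tendsto (kernel ρ) (cocompact ℝ) (𝓝 0) := by
    have h0 := Real.zero_at_infty_fourier (fun s : ℝ => (ρ (2 * Real.pi * s) : ℂ))
    have h1 := h0.comp (Homeomorph.neg ℝ).isClosedEmbedding.tendsto_cocompact
    refine h1.congr fun x => ?_
    rw [kernel_eq_fourierInv, Real.fourierInv_eq_fourier_neg]; rfl
  have hku : UniformContinuous (kernel ρ) := hkc.uniformContinuous_of_tendsto_cocompact hkt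
  obtain ⟨C, hC0, hC⟩ := norm_kernel_le ρ
  have hm : ∀ t, MemLp (fun x => kernel ρ (x - t)) 2 (volume.restrict A) := fun t =>
    MemLp.of_bound (hkc.comp (continuous_id.sub continuous_const)).aestronglyMeasurable C
      (ae_of_all _ fun x => hC _)
  -- the slices `x ↦ h (x - t)`
  let e : ℝ → L2 A := fun t => (hm t).toLp _
  have hec : ∀ t, e t =ᵐ[volume.restrict A] fun x => kernel ρ (x - t) := fun t =>
    (hm t).coeFn_toLp
  have hcont : Continuous e := by
    rw [Metric.continuous_iff]
    intro t ε hε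
    set B : ℝ := (measureUnivNNReal (volume.restrict A) : ℝ) ^ (2 : ENNReal).toReal⁻¹ with hB
    have hB0 : 0 ≤ B := by positivity
    obtain ⟨δ, hδ, hd⟩ := Metric.uniformContinuous_iff.1 hku (ε / (B + 1)) (by positivity)
    refine ⟨δ, hδ, fun s hs => ?_⟩
    rw [dist_eq_norm]
    have := Lp.norm_le_of_ae_bound (f := e s - e t) (C := ε / (B + 1)) (by positivity) (by
      filter_upwards [Lp.coeFn_sub (e s) (e t), hec s, hec t] with x h1 h2 h3
      rw [h1, Pi.sub_apply, h2, h3, ← dist_eq_norm]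
      refine (hd ?_).le
      rw [Real.dist_eq] at hs ⊢
      rwa [show x - s - (x - t) = -(s - t) by ring, abs_neg])
    refine lt_of_le_of_lt this ?_
    rw [← hB, mul_div_assoc', div_lt_iff₀ (by positivity)]
    nlinarith
  have hHin : ∀ f : L2 A, H f =ᵐ[volume.restrict A] fun x => ⟪e x, f⟫_ℂ := fun f => by
    refine (hHs f).trans (ae_of_all _ fun x => ?_)
    simp only
    rw [L2.inner_def]
    refine integral_congr_ae ?_
    filter_upwards [hec x] with t ht
    rw [RCLike.inner_apply, ht, conj_kernel, neg_sub, mul_comm]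
  have hsym : ∀ w f : L2 A, ⟪w, H f⟫_ℂ = ⟪H w, f⟫_ℂ := fun w f => by
    have hwi : Integrable w (volume.restrict A) := (Lp.memLp w).integrable (by norm_num)
    have hfi : Integrable f (volume.restrict A) := (Lp.memLp f).integrable (by norm_num)
    have e1 : ⟪w, H f⟫_ℂ = ∫ x in A, ∫ t in A, kernel ρ (x - t) * f t * (starRingEnd ℂ) (w x) := by
      rw [L2.inner_def]
      refine integral_congr_ae ?_
      filter_upwards [hHs f] with x hx
      rw [RCLike.inner_apply, hx, ← integral_mul_const]
    have e2 : ⟪H w, f⟫_ℂ = ∫ t in A, ∫ x in A, kernel ρ (x - t) * f t * (starRingEnd ℂ) (w x) := by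
      rw [L2.inner_def]
      refine integral_congr_ae ?_
      filter_upwards [hHs w] with t ht
      rw [RCLike.inner_apply, ht, ← integral_conj, ← integral_const_mul]
      refine integral_congr_ae (ae_of_all _ fun x => ?_)
      simp only [map_mul, conj_kernel, neg_sub]
      ring
    rw [e1, e2]
    refine integral_integral_swap ?_
    have hp : Integrable (fun p : ℝ × ℝ => (starRingEnd ℂ) (w p.1) * f p.2)
        ((volume.restrict A).prod (volume.restrict A)) :=
      (LinearIsometryEquiv.integrable_comp_iff (Complex.conjLIE) |>.2 hwi).mul_prod hfi
    have := hp.bdd_mul (c := C) (f := fun p : ℝ × ℝ => kernel ρ (p.1 - p.2))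
      (hkc.comp (continuous_fst.sub continuous_snd)).aestronglyMeasurable
      (ae_of_all _ fun p => hC _)
    refine this.congr (ae_of_all _ fun p => ?_)
    simp only [Function.uncurry]
    ring
  refine ⟨fun x t => (μ : ℂ) * kernel ρ (x - t) + (μ : ℂ) ^ 2 * ⟪e x, N (e t)⟫_ℂ, ?_, fun f => ?_⟩
  · refine Continuous.continuousOn ?_
    simp only [Function.uncurry_def]
    have h1 : Continuous fun p : ℝ × ℝ => N (e p.2) := N.continuous.comp (hcont.comp continuous_snd)
    have h2 : Continuous fun p : ℝ × ℝ => e p.1 := hcont.comp continuous_fst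
    have h3 : Continuous fun p : ℝ × ℝ => kernel ρ (p.1 - p.2) :=
      hkc.comp (continuous_fst.sub continuous_snd)
    exact (continuous_const.mul h3).add (continuous_const.mul (h2.inner h1))
  · have hNf : ∀ g, N g = g + (μ : ℂ) • H (N g) := fun g => by
      have : opS ρ μ A (N g) = g := hinv.self_apply_inverse g
      rw [opS, sub_apply, one_apply_eq_self,
        smul_apply, sub_eq_iff_eq_add] at this
      exact this
    have hNf' : ∀ g, N g = g + (μ : ℂ) • N (H g) := fun g => by
      have : N (opS ρ μ A g) = g := hinv.inverse_apply_self g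
      rw [opS, sub_apply, one_apply_eq_self,
        smul_apply, map_sub, map_smul, sub_eq_iff_eq_add] at this
      exact this
    have hx : ∀ x, ⟪e x, N (H f)⟫_ℂ = ∫ t in A, ⟪e x, N (e t)⟫_ℂ * f t := fun x => by
      set w := (ContinuousLinearMap.adjoint N) (e x) with hw
      rw [← ContinuousLinearMap.adjoint_inner_left, hsym, L2.inner_def]
      refine integral_congr_ae ?_
      filter_upwards [hHin w] with t ht
      rw [RCLike.inner_apply, ht, inner_conj_symm, hw,
        ContinuousLinearMap.adjoint_inner_left, mul_comm]
    have hd : N f = f + (μ : ℂ) • H f + ((μ : ℂ) ^ 2) • H (N (H f)) := by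
      conv_lhs => rw [hNf f, hNf' f]
      rw [map_add, map_smul, smul_add, smul_smul, sq, add_assoc]
    rw [hd]
    filter_upwards [Lp.coeFn_add (f + (μ : ℂ) • H f) (((μ : ℂ) ^ 2) • H (N (H f))),
      Lp.coeFn_add f ((μ : ℂ) • H f), Lp.coeFn_smul (μ : ℂ) (H f),
      Lp.coeFn_smul ((μ : ℂ) ^ 2) (H (N (H f))), hHs f, hHin (N (H f))] with x h1 h2 h3 h4 h5 h6
    rw [h1, Pi.add_apply, h2, Pi.add_apply, h3, h4, Pi.smul_apply, Pi.smul_apply, h5, h6, hx,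
      add_assoc, smul_eq_mul, smul_eq_mul, ← integral_const_mul, ← integral_const_mul,
      ← integral_add]
    · congr 1
      refine integral_congr_ae (ae_of_all _ fun t => ?_)
      simp only
      ring
    · exact (integrable_kernel_mul hb hi f x).const_mul _
    · have hfi : Integrable f (volume.restrict A) := (Lp.memLp f).integrable (by norm_num)
      have hcx : Continuous fun t => ⟪e x, N (e t)⟫_ℂ :=
        continuous_const.inner (N.continuous.comp hcont)
      obtain ⟨D, hD⟩ := (isCompact_Icc (a := (0 : ℝ)) (b := ξ)).exists_bound_of_continuousOn
        hcx.continuousOn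
      refine (hfi.bdd_mul (c := D) hcx.aestronglyMeasurable ?_).const_mul _
      exact (ae_restrict_iff' hAm).2 (ae_of_all _ fun t ht => hD t (Ioo_subset_Icc_self ht))

open Classical in
/-- The resolvent kernel `R_ξ(x,t)`. It exists when `|ρ| ≤ U` and `|μ| U < 1`, see
`resolventKernel_spec`, and its values on `[0,ξ]²` are then determined by continuity. -/
noncomputable def resolventKernel (ρ : ℝ → ℝ) (μ ξ : ℝ) : ℝ → ℝ → ℂ :=
  if h : ∃ K, IsResolventKernel ρ μ ξ K then h.choose else 0

theorem resolventKernel_spec {ρ : ℝ → ℝ} {U μ : ℝ} (hb : ∀ l, |ρ l| ≤ U) (hi : Integrable ρ)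
    (hμ : |μ| * U < 1) (ξ : ℝ) : IsResolventKernel ρ μ ξ (resolventKernel ρ μ ξ) := by
  have h := exists_isResolventKernel hb hi hμ ξ
  rw [resolventKernel, dif_pos h]
  exact h.choose_spec

/-! ### The canonical system -/

/-- `M(x) = 1/2 - μ ∫_0^x h(s) ds`. -/
noncomputable def massM (ρ : ℝ → ℝ) (μ x : ℝ) : ℂ :=
  1 / 2 - (μ : ℂ) * ∫ s in (0 : ℝ)..x, kernel ρ s

/-- `q₁(x) = 1 + ∫_0^x R_x(x,t) dt`. -/
noncomputable def q₁ (ρ : ℝ → ℝ) (μ x : ℝ) : ℂ :=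
  1 + ∫ t in (0 : ℝ)..x, resolventKernel ρ μ x x t

/-- `q₂(x) = M(x) + ∫_0^x M(t) R_x(x,t) dt`. -/
noncomputable def q₂ (ρ : ℝ → ℝ) (μ x : ℝ) : ℂ :=
  massM ρ μ x + ∫ t in (0 : ℝ)..x, massM ρ μ t * resolventKernel ρ μ x x t

/-- The Hamiltonian `H(x)` of the canonical system. -/
noncomputable def hamiltonian (ρ : ℝ → ℝ) (μ x : ℝ) : Matrix (Fin 2) (Fin 2) ℂ :=
  !![q₂ ρ μ x ^ 2, 1 / 2; 1 / 2, q₁ ρ μ x ^ 2]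

/-- The signature matrix `J`. -/
def matJ : Matrix (Fin 2) (Fin 2) ℂ := !![0, 1; 1, 0]

/-- `W(x,z)` solves `dW/dx = i z J H(x) W`, `W(0,z) = I₂`, on `0 ≤ x < ∞`, for every complex `z`
(the derivative is taken entry by entry, one-sided at `x = 0`). -/
def IsCanonicalSolution (ρ : ℝ → ℝ) (μ : ℝ) (W : ℝ → ℂ → Matrix (Fin 2) (Fin 2) ℂ) : Prop :=
  ∀ z : ℂ, W 0 z = 1 ∧ ∀ x : ℝ, 0 ≤ x → ∀ i j : Fin 2,
    HasDerivWithinAt (fun y => W y z i j)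
      (((Complex.I * z) • (matJ * hamiltonian ρ μ x * W x z)) i j) (Ici 0) x

/-! ### The limit function `G` -/

/-- The improper integral `∫_x^∞ h(t) dt = lim_{X → ∞} ∫_x^X h(t) dt`. -/
noncomputable def tailIntegral (ρ : ℝ → ℝ) (x : ℝ) : ℂ :=
  limUnder atTop fun X : ℝ => ∫ t in x..X, kernel ρ t

/-- `q(x) = M(x) - (1 - μ)/2`. -/
noncomputable def qFun (ρ : ℝ → ℝ) (μ x : ℝ) : ℂ := massM ρ μ x - (1 - (μ : ℂ)) / 2

open Classical in
/-- The class of a square-integrable function in `L²(A)` (and `0` for any other function). -/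
noncomputable def toL2 (A : Set ℝ) (g : ℝ → ℂ) : L2 A :=
  if h : MemLp g 2 (volume.restrict A) then h.toLp g else 0

/-- `r = S⁻¹ q` in `L²(0,∞)`. -/
noncomputable def rFun (ρ : ℝ → ℝ) (μ : ℝ) : L2 (Ioi 0) :=
  (fullS ρ μ).inverse (toL2 (Ioi 0) (qFun ρ μ))

/-- `G(z) = (1 - μ)⁻¹ [1 - i z ∫_0^∞ e^{-i z x} r(x) dx]`; used for `Im z < 0`, where the integral
converges absolutely. -/
noncomputable def limitG (ρ : ℝ → ℝ) (μ : ℝ) (z : ℂ) : ℂ :=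
  1 / (1 - (μ : ℂ)) *
    (1 - Complex.I * z * ∫ x in Ioi (0 : ℝ), Complex.exp (-(Complex.I * z * x)) * rFun ρ μ x)

/-! ### Triangular factorization -/

/-- The orthogonal projection `P_ξ` of `L²(A)`: `P_ξ f` is `f` on `x < ξ` and `0` elsewhere. -/
noncomputable def projP (A : Set ℝ) (ξ : ℝ) : L2 A →L[ℂ] L2 A :=
  LinearMap.mkContinuous
    { toFun := fun f => ((Lp.memLp f).indicator (measurableSet_Iio (a := ξ))).toLp _
      map_add' := fun f g => by
        rw [← MemLp.toLp_add]
        refine MemLp.toLp_congr _ _ ?_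
        filter_upwards [Lp.coeFn_add f g] with x hx
        rw [Pi.add_apply] at hx
        by_cases h : x ∈ Iio ξ
        · rw [Pi.add_apply, indicator_of_mem h, indicator_of_mem h, indicator_of_mem h, hx]
        · rw [Pi.add_apply, indicator_of_notMem h, indicator_of_notMem h, indicator_of_notMem h,
            add_zero]
      map_smul' := fun c f => by
        rw [RingHom.id_apply, ← MemLp.toLp_const_smul]
        refine MemLp.toLp_congr _ _ ?_
        filter_upwards [Lp.coeFn_smul c f] with x hx
        rw [Pi.smul_apply] at hx
        by_cases h : x ∈ Iio ξ
        · rw [Pi.smul_apply, indicator_of_mem h, indicator_of_mem h, hx]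
        · rw [Pi.smul_apply, indicator_of_notMem h, indicator_of_notMem h, smul_zero] }
    1 fun f => by
      rw [one_mul]
      refine Lp.norm_le_norm_of_ae_le ?_
      filter_upwards [((Lp.memLp f).indicator (measurableSet_Iio (a := ξ))).coeFn_toLp] with x hx
      refine (congrArg norm hx).trans_le ?_
      exact norm_indicator_le_norm_self _ _

/-- `Q_ξ = I - P_ξ`. -/
noncomputable def projQ (A : Set ℝ) (ξ : ℝ) : L2 A →L[ℂ] L2 A := 1 - projP A ξ

/-- `T` is lower triangular: `T Q_ξ = Q_ξ T Q_ξ` for every `ξ`. -/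
def IsLowerTriangular {A : Set ℝ} (T : L2 A →L[ℂ] L2 A) : Prop :=
  ∀ ξ : ℝ, T ∘L projQ A ξ = projQ A ξ ∘L T ∘L projQ A ξ

/-- `T` admits a (left) triangular factorization: `T = S₋ S₋*` with `S₋` and `S₋⁻¹` bounded and
lower triangular. Such a `T` is automatically bounded, positive definite and invertible. -/
def AdmitsTriangularFactorization {A : Set ℝ} (T : L2 A →L[ℂ] L2 A) : Prop :=
  ∃ Sm : (L2 A →L[ℂ] L2 A)ˣ,
    IsLowerTriangular (Sm : L2 A →L[ℂ] L2 A) ∧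
    IsLowerTriangular ((Sm⁻¹ : (L2 A →L[ℂ] L2 A)ˣ) : L2 A →L[ℂ] L2 A) ∧
    T = (Sm : L2 A →L[ℂ] L2 A) ∘L ContinuousLinearMap.adjoint (Sm : L2 A →L[ℂ] L2 A)

end WienerHopf

open WienerHopf

namespace WienerHopf

/-! The assumption `hfail` can never be met: under the remaining hypotheses both limit relations
hold, so the proposition is true by contradiction with `hfail`, and triangular factorization is not
examined. The work is to prove the two limits.

Write `k = μ h` and let `S_ξ⁻¹ g` denote the continuous solution of `φ = g + ∫_0^ξ k(x - t) φ(t)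
dt`. Since `k` is even, `S_ξ` is symmetric for the bilinear pairing and commutes with `x ↦ ξ - x`.
Symmetry gives the derivative of `∫_0^ξ (S_ξ⁻¹ f) g` in `ξ`: it is the product of the endpoint
values of `S_ξ⁻¹ f` and `S_ξ⁻¹ g` (`hasDerivWithinAt_integral_truncSol`). The endpoint values for
`1` and `M` are `q₁` and `q₂`, and reflection yields `q₁ q₂ = 1/2` (`truncSol_mass_mul_one`). A
commutation identity expresses the endpoint value for `e^{izx}` through `q₁` and `q₂`
(`truncSol_exp_diagonal`). Together these show that `iz ∫ S_ξ⁻¹ e^{izx}` and `1 + iz ∫ M S_ξ⁻¹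
e^{izx}` solve the canonical system, so `w₁₂(ξ,z) = iz ∫_0^ξ e^{izx} (S_ξ⁻¹ 1)(x) dx`
(`canonicalSolution_entry`).

For the limit, `M = q + (1 - μ)/2` gives `(1 - μ) S_ξ⁻¹ 1 = 1 - φ(x) - φ(ξ - x)` with `φ = S_ξ⁻¹ q`
(`truncSol_one_decomposition`). As `q` is in `L²`, the finite sections `S_ξ⁻¹ q` converge to `r =
S⁻¹ q` (`tendsto_truncVec_truncSol`). Against a decaying exponential the constant and `φ(x)` produce
`G`, while the reflected term vanishes (`tendsto_conv_exp`). The upper half plane follows by complex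
conjugation. -/

/-! ### Continuous solutions of the truncated equation -/

/-- `φ` is a continuous solution on the whole line of `φ(x) = g(x) + ∫_0^ξ k(x - t) φ(t) dt`. -/
structure IsTruncSol (k : ℝ → ℂ) (ξ : ℝ) (g φ : ℝ → ℂ) : Prop where
  cont : Continuous φ
  eqn : ∀ x, φ x = g x + ∫ t in (0 : ℝ)..ξ, k (x - t) * φ t

/-- Solutions of the truncated equations are bounded by the right-hand side, uniformly for bounded
interval lengths. -/
def HasAprioriBound (k : ℝ → ℂ) : Prop :=
  ∀ b : ℝ, ∃ c : ℝ, 0 ≤ c ∧ ∀ ξ ∈ Icc 0 b, ∀ (g φ : ℝ → ℂ) (m : ℝ), IsTruncSol k ξ g φ →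
    (∀ x ∈ Icc 0 ξ, ‖g x‖ ≤ m) → ∀ x, ‖φ x‖ ≤ ‖g x‖ + c * m

section
variable {k f g φ ψ : ℝ → ℂ} {ξ η : ℝ}

theorem intervalIntegrable_conv (hk : Continuous k) (hφ : Continuous φ) (x a b : ℝ) :
    IntervalIntegrable (fun t => k (x - t) * φ t) volume a b :=
  Continuous.intervalIntegrable (by fun_prop) a b

theorem IsTruncSol.add (hk : Continuous k) (hφ : IsTruncSol k ξ f φ) (hψ : IsTruncSol k ξ g ψ) :
    IsTruncSol k ξ (fun x => f x + g x) (fun x => φ x + ψ x) := by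
  refine ⟨hφ.cont.add hψ.cont, fun x => ?_⟩
  simp only [mul_add]
  rw [intervalIntegral.integral_add (intervalIntegrable_conv hk hφ.cont x _ _)
    (intervalIntegrable_conv hk hψ.cont x _ _), hφ.eqn x, hψ.eqn x]
  ring

theorem IsTruncSol.const_mul (c : ℂ) (hφ : IsTruncSol k ξ f φ) :
    IsTruncSol k ξ (fun x => c * f x) (fun x => c * φ x) := by
  refine ⟨hφ.cont.const_mul c, fun x => ?_⟩
  simp only [mul_left_comm _ c]
  rw [intervalIntegral.integral_const_mul, ← mul_add, ← hφ.eqn x]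

theorem IsTruncSol.sub (hk : Continuous k) (hφ : IsTruncSol k ξ f φ) (hψ : IsTruncSol k ξ g ψ) :
    IsTruncSol k ξ (fun x => f x - g x) (fun x => φ x - ψ x) := by
  simpa [sub_eq_add_neg] using hφ.add hk (hψ.const_mul (-1))

theorem IsTruncSol.unique (hk : Continuous k) (hb : HasAprioriBound k) (hξ : 0 ≤ ξ)
    (hφ : IsTruncSol k ξ g φ) (hψ : IsTruncSol k ξ g ψ) : φ = ψ := by
  obtain ⟨c, -, hc⟩ := hb ξ
  funext x
  have := hc ξ ⟨hξ, le_rfl⟩ _ _ 0 (hφ.sub hk hψ) (by intros; simp) x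
  simpa [sub_eq_zero] using this

/-- An even difference kernel is unchanged when both arguments are reflected in the midpoint of
`[0,ξ]`, so the truncated operator commutes with `x ↦ ξ - x`. -/
theorem IsTruncSol.reflect (hev : ∀ x, k (-x) = k x) (hφ : IsTruncSol k ξ g φ) :
    IsTruncSol k ξ (fun x => g (ξ - x)) (fun x => φ (ξ - x)) := by
  refine ⟨hφ.cont.comp (continuous_const.sub continuous_id), fun x => ?_⟩
  have h := intervalIntegral.integral_comp_sub_left (a := 0) (b := ξ)
    (fun t => k (ξ - x - t) * φ t) ξ
  rw [sub_self, sub_zero] at h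
  rw [hφ.eqn (ξ - x), ← h]
  congr 1
  refine intervalIntegral.integral_congr fun t _ => ?_
  rw [← hev, show -(ξ - x - (ξ - t)) = x - t by ring]

theorem IsTruncSol.conj (hr : ∀ x, (starRingEnd ℂ) (k x) = k x) (hφ : IsTruncSol k ξ g φ) :
    IsTruncSol k ξ (fun x => (starRingEnd ℂ) (g x)) (fun x => (starRingEnd ℂ) (φ x)) := by
  refine ⟨Complex.continuous_conj.comp hφ.cont, fun x => ?_⟩
  conv_lhs => rw [hφ.eqn x]
  rw [map_add, ← intervalIntegral.intervalIntegral_conj]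
  simp [hr]

/-! ### Symmetry of the bilinear pairing and dependence on the interval length. -/

theorem integral_integral_swap_of_continuous {F : ℝ → ℝ → ℂ} (hF : Continuous F.uncurry)
    (a b c d : ℝ) :
    ∫ x in a..b, ∫ y in c..d, F x y = ∫ y in c..d, ∫ x in a..b, F x y :=
  intervalIntegral_intervalIntegral_swap ((hF.continuousOn.integrableOn_compact
    (isCompact_uIcc.prod isCompact_uIcc)).mono_set
      (prod_mono uIoc_subset_uIcc uIoc_subset_uIcc))

theorem integral_conv_swap (hk : Continuous k) (hev : ∀ x, k (-x) = k x) (hφ : Continuous φ)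
    (hψ : Continuous ψ) (a b c d : ℝ) :
    ∫ x in a..b, φ x * ∫ t in c..d, k (x - t) * ψ t =
      ∫ t in c..d, ψ t * ∫ x in a..b, k (t - x) * φ x := by
  simp only [← intervalIntegral.integral_const_mul]
  rw [integral_integral_swap_of_continuous (by fun_prop)]
  refine intervalIntegral.integral_congr fun t _ => intervalIntegral.integral_congr fun x _ => ?_
  rw [← hev, neg_sub]
  ring

/-- Both sides are the double integral of `φ(x) k(x - t) ψ(t)` over `[0,ξ] × [0,η]`. The two lengths
may differ, which is what makes solutions on different intervals comparable. -/
theorem IsTruncSol.integral_mul_sub (hk : Continuous k) (hev : ∀ x, k (-x) = k x)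
    (hφ : IsTruncSol k ξ f φ) (hψ : IsTruncSol k η g ψ) :
    ∫ x in (0 : ℝ)..ξ, φ x * (ψ x - g x) = ∫ x in (0 : ℝ)..η, ψ x * (φ x - f x) := by
  have h := integral_conv_swap hk hev hφ.cont hψ.cont 0 ξ 0 η
  have e1 : ∀ x, ∫ t in (0 : ℝ)..η, k (x - t) * ψ t = ψ x - g x := fun x => by
    rw [hψ.eqn x]; ring
  have e2 : ∀ x, ∫ t in (0 : ℝ)..ξ, k (x - t) * φ t = φ x - f x := fun x => by
    rw [hφ.eqn x]; ring
  simpa only [e1, e2] using h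

theorem IsTruncSol.integral_mul_comm (hk : Continuous k) (hev : ∀ x, k (-x) = k x)
    (hf : Continuous f) (hg : Continuous g)
    (hφ : IsTruncSol k ξ f φ) (hψ : IsTruncSol k ξ g ψ) :
    ∫ x in (0 : ℝ)..ξ, φ x * g x = ∫ x in (0 : ℝ)..ξ, ψ x * f x := by
  have h := hφ.integral_mul_sub hk hev hψ
  have hφc := hφ.cont
  have hψc := hψ.cont
  simp only [mul_sub] at h
  rw [intervalIntegral.integral_sub (Continuous.intervalIntegrable (by fun_prop) _ _)
      (Continuous.intervalIntegrable (by fun_prop) _ _),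
    intervalIntegral.integral_sub (Continuous.intervalIntegrable (by fun_prop) _ _)
      (Continuous.intervalIntegrable (by fun_prop) _ _)] at h
  simp only [mul_comm (ψ _) (φ _)] at h
  exact sub_right_injective h

/-- The increment of `∫_0^ξ φ_ξ g`, where `φ_ξ` solves the truncated equation. -/
theorem IsTruncSol.integral_mul_increment {φ' : ℝ → ℂ} (hk : Continuous k)
    (hev : ∀ x, k (-x) = k x) (hf : Continuous f) (hg : Continuous g)
    (hφ : IsTruncSol k ξ f φ) (hφ' : IsTruncSol k η f φ') (hψ : IsTruncSol k η g ψ) :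
    (∫ x in (0 : ℝ)..η, φ' x * g x) - ∫ x in (0 : ℝ)..ξ, φ x * g x =
      ∫ x in ξ..η, φ x * ψ x := by
  have h := hφ.integral_mul_sub hk hev hψ
  have hφc := hφ.cont
  have hψc := hψ.cont
  have hi : ∀ a b, IntervalIntegrable (fun x => φ x * ψ x) volume a b := fun a b =>
    Continuous.intervalIntegrable (by fun_prop) a b
  simp only [mul_sub] at h
  rw [intervalIntegral.integral_sub (hi _ _) (Continuous.intervalIntegrable (by fun_prop) _ _),
    intervalIntegral.integral_sub (Continuous.intervalIntegrable (by fun_prop) _ _)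
      (Continuous.intervalIntegrable (by fun_prop) _ _)] at h
  simp only [mul_comm (ψ _) (φ _)] at h
  -- Symmetry on `[0,η]` trades `φ'` for `ψ`, leaving only `φ` and `ψ`; their products over `[0,ξ]`
  -- then cancel against the two-interval identity `h`.
  rw [hφ'.integral_mul_comm hk hev hf hg hψ, ← intervalIntegral.integral_add_adjacent_intervals
    (hi ξ 0) (hi 0 η), intervalIntegral.integral_symm 0 ξ]
  linear_combination h

/-- Solutions are Lipschitz in the length of the interval. -/
theorem exists_lipschitz_truncSol {Φ : ℝ → ℝ → ℂ} (hk : Continuous k) {C : ℝ}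
    (hC : ∀ x, ‖k x‖ ≤ C) (hb : HasAprioriBound k)
    (hΦ : ∀ ξ, 0 ≤ ξ → IsTruncSol k ξ g (Φ ξ)) (hξ : 0 ≤ ξ) :
    ∃ L, 0 ≤ L ∧ ∀ η ∈ Icc 0 (ξ + 1), ∀ x, ‖Φ η x - Φ ξ x‖ ≤ L * |η - ξ| := by
  obtain ⟨c, hc0, hc⟩ := hb (ξ + 1)
  obtain ⟨m, hm⟩ := (isCompact_Icc (a := (0 : ℝ)) (b := ξ + 1)).exists_bound_of_continuousOn
    (hΦ ξ hξ).cont.continuousOn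
  have hm0 : 0 ≤ m := (norm_nonneg _).trans (hm 0 ⟨le_rfl, by linarith⟩)
  have hC0 : 0 ≤ C := (norm_nonneg _).trans (hC 0)
  refine ⟨C * m + c * (C * m), by positivity, fun η hη x => ?_⟩
  -- The difference solves the equation on `[0,η]` whose source is the part of the convolution over
  -- `[ξ,η]`, a quantity of size `|η - ξ|`; the a priori bound then applies.
  have hsol : IsTruncSol k η (fun x => ∫ t in ξ..η, k (x - t) * Φ ξ t)
      (fun x => Φ η x - Φ ξ x) := by
    refine ⟨(hΦ η hη.1).cont.sub (hΦ ξ hξ).cont, fun x => ?_⟩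
    simp only [mul_sub]
    have hi := fun a b => intervalIntegrable_conv hk (hΦ ξ hξ).cont x a b
    rw [intervalIntegral.integral_sub (intervalIntegrable_conv hk (hΦ η hη.1).cont x _ _) (hi _ _),
      (hΦ η hη.1).eqn x, (hΦ ξ hξ).eqn x,
      ← intervalIntegral.integral_add_adjacent_intervals (hi 0 ξ) (hi ξ η)]
    ring
  have hp : ∀ x, ‖∫ t in ξ..η, k (x - t) * Φ ξ t‖ ≤ C * m * |η - ξ| := fun x => by
    refine intervalIntegral.norm_integral_le_of_norm_le_const fun t ht => ?_
    rw [norm_mul]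
    refine mul_le_mul (hC _) (hm t ?_) (norm_nonneg _) hC0
    have := uIoc_subset_uIcc ht
    exact uIcc_subset_Icc ⟨hξ, by linarith⟩ hη this
  refine (hc η hη _ _ _ hsol (fun x _ => hp x) x).trans ?_
  nlinarith [hp x]

/-- The derivative in `ξ` of the bilinear form of the inverse of the truncated operator. -/
theorem hasDerivWithinAt_integral_truncSol {Φ Ψ : ℝ → ℝ → ℂ} (hk : Continuous k)
    (hev : ∀ x, k (-x) = k x) {C : ℝ} (hC : ∀ x, ‖k x‖ ≤ C) (hb : HasAprioriBound k)
    (hf : Continuous f) (hg : Continuous g) (hΦ : ∀ ξ, 0 ≤ ξ → IsTruncSol k ξ f (Φ ξ))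
    (hΨ : ∀ ξ, 0 ≤ ξ → IsTruncSol k ξ g (Ψ ξ)) (hξ : 0 ≤ ξ) :
    HasDerivWithinAt (fun ξ => ∫ x in (0 : ℝ)..ξ, Φ ξ x * g x) (Φ ξ ξ * Ψ ξ ξ) (Ici 0) ξ := by
  obtain ⟨L, hL0, hL⟩ := exists_lipschitz_truncSol hk hC hb hΨ hξ
  obtain ⟨m, hm⟩ := (isCompact_Icc (a := (0 : ℝ)) (b := ξ + 1)).exists_bound_of_continuousOn
    (hΦ ξ hξ).cont.continuousOn
  have hm0 : 0 ≤ m := (norm_nonneg _).trans (hm 0 ⟨le_rfl, by linarith⟩)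
  have hc : Continuous fun x => Φ ξ x * Ψ ξ x := (hΦ ξ hξ).cont.mul (hΨ ξ hξ).cont
  have h1 : HasDerivAt (fun η => ∫ x in ξ..η, Φ ξ x * Ψ ξ x) (Φ ξ ξ * Ψ ξ ξ) ξ :=
    intervalIntegral.integral_hasDerivAt_right (hc.intervalIntegrable _ _)
      (hc.stronglyMeasurableAtFilter _ _) hc.continuousAt
  -- The increment is `∫_ξ^η Φ_ξ Ψ_η`. Replacing `Ψ_η` by `Ψ_ξ` costs an error of order `(η - ξ)²`:
  -- one factor from the length of the interval, one from the Lipschitz bound.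
  have h2 : HasDerivWithinAt (fun η => ∫ x in ξ..η, Φ ξ x * (Ψ η x - Ψ ξ x)) 0 (Ici 0) ξ := by
    rw [hasDerivWithinAt_iff_isLittleO]
    have hO : (fun η => (∫ x in ξ..η, Φ ξ x * (Ψ η x - Ψ ξ x)) -
        (∫ x in ξ..ξ, Φ ξ x * (Ψ ξ x - Ψ ξ x)) - (η - ξ) • (0 : ℂ)) =O[𝓝[Ici 0] ξ]
        fun η => (η - ξ) ^ 2 := by
      refine Asymptotics.IsBigO.of_bound (m * L) ?_
      have hn : Iic (ξ + 1) ∈ 𝓝[Ici 0] ξ :=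
        mem_nhdsWithin_of_mem_nhds (Iic_mem_nhds (by linarith))
      filter_upwards [hn, self_mem_nhdsWithin] with η h1 h0
      rw [intervalIntegral.integral_same, sub_zero, smul_zero, sub_zero, norm_pow, sq,
        Real.norm_eq_abs, ← mul_assoc]
      refine intervalIntegral.norm_integral_le_of_norm_le_const fun t ht => ?_
      rw [norm_mul, mul_assoc]
      refine mul_le_mul (hm t ?_) (hL η ⟨h0, h1⟩ t) (norm_nonneg _) hm0
      exact uIcc_subset_Icc ⟨hξ, by linarith⟩ ⟨h0, h1⟩ (uIoc_subset_uIcc ht)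
    refine hO.trans_isLittleO ?_
    have := (Asymptotics.isLittleO_pow_id (𝕜 := ℝ) (n := 2) (by norm_num)).comp_tendsto
      (k := fun η : ℝ => η - ξ) (l' := 𝓝[Ici 0] ξ) (by
        have : Tendsto (fun η : ℝ => η - ξ) (𝓝 ξ) (𝓝 (ξ - ξ)) :=
          (continuous_id.sub continuous_const).tendsto ξ
        rw [sub_self] at this
        exact this.mono_left nhdsWithin_le_nhds)
    exact this
  have h3 := (h1.hasDerivWithinAt (s := Ici 0)).add h2
  rw [add_zero] at h3
  have h4 := h3.const_add (∫ x in (0 : ℝ)..ξ, Φ ξ x * g x)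
  refine h4.congr_of_mem (fun η hη => ?_) hξ
  have hη0 : (0 : ℝ) ≤ η := hη
  have := (hΦ ξ hξ).integral_mul_increment hk hev hf hg (hΦ η hη0) (hΨ η hη0)
  have hs : ∫ x in ξ..η, Φ ξ x * Ψ η x =
      (∫ x in ξ..η, Φ ξ x * Ψ ξ x) + ∫ x in ξ..η, Φ ξ x * (Ψ η x - Ψ ξ x) := by
    have c1 := (hΦ ξ hξ).cont
    have c2 := (hΨ ξ hξ).cont
    have c3 := (hΨ η hη0).cont
    rw [← intervalIntegral.integral_add (hc.intervalIntegrable _ _)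
      (Continuous.intervalIntegrable (by fun_prop) _ _)]
    refine intervalIntegral.integral_congr fun x _ => ?_
    ring
  rw [Pi.add_apply, ← hs, ← this]
  ring

end
/-! ### The mass function and the exponentials -/

section
variable {k M f φ ψ : ℝ → ℂ} {ξ : ℝ}

theorem hasDerivAt_integral_of_continuous (hk : Continuous k) (a x : ℝ) :
    HasDerivAt (fun x => ∫ s in a..x, k s) (k x) x :=
  intervalIntegral.integral_hasDerivAt_right (hk.intervalIntegrable _ _)
    (hk.stronglyMeasurableAtFilter _ _) hk.continuousAt

theorem integral_neg_of_even (hev : ∀ x, k (-x) = k x) (x : ℝ) :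
    ∫ s in (0 : ℝ)..(-x), k s = -∫ s in (0 : ℝ)..x, k s := by
  have h := intervalIntegral.integral_comp_neg (a := 0) (b := x) k
  simp only [hev, neg_zero] at h
  rw [intervalIntegral.integral_symm, ← h]

theorem integral_sub_left_of_even (hk : Continuous k) (hev : ∀ x, k (-x) = k x) (x a : ℝ) :
    ∫ t in (0 : ℝ)..a, k (x - t) = (∫ s in (0 : ℝ)..x, k s) + ∫ s in (0 : ℝ)..(a - x), k s := by
  have h := intervalIntegral.integral_comp_sub_left (a := 0) (b := a) k x
  rw [sub_zero] at h
  rw [h, ← neg_sub x a, integral_neg_of_even hev, ← sub_eq_add_neg,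
    intervalIntegral.integral_interval_sub_left (hk.intervalIntegrable _ _)
      (hk.intervalIntegrable _ _)]

/-- By evenness the convolution of `k` with `1` over `[0,ξ]` is the primitive of `k` at `x` plus
that at `ξ - x`. The constant `1/2` in `M` is chosen so that `S_ξ 1` becomes `M` plus its
reflection. -/
theorem isTruncSol_one (hk : Continuous k) (hev : ∀ x, k (-x) = k x)
    (hM : ∀ x, M x = 1 / 2 - ∫ s in (0 : ℝ)..x, k s) :
    IsTruncSol k ξ (fun x => M x + M (ξ - x)) (fun _ => 1) := by
  refine ⟨continuous_const, fun x => ?_⟩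
  simp only [mul_one]
  rw [integral_sub_left_of_even hk hev, hM, hM]
  ring

theorem truncSol_mass_add_reflect (hk : Continuous k) (hev : ∀ x, k (-x) = k x)
    (hb : HasAprioriBound k) (hM : ∀ x, M x = 1 / 2 - ∫ s in (0 : ℝ)..x, k s) (hξ : 0 ≤ ξ)
    (hφ : IsTruncSol k ξ M φ) (x : ℝ) : φ x + φ (ξ - x) = 1 :=
  congrFun ((hφ.add hk (hφ.reflect hev)).unique hk hb hξ (isTruncSol_one hk hev hM)) x

/-- A function and its reflection have the same integral over `[0,ξ]`, and here their sum is `1`. -/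
theorem integral_truncSol_mass (hk : Continuous k) (hev : ∀ x, k (-x) = k x)
    (hb : HasAprioriBound k) (hM : ∀ x, M x = 1 / 2 - ∫ s in (0 : ℝ)..x, k s) (hξ : 0 ≤ ξ)
    (hφ : IsTruncSol k ξ M φ) : ∫ x in (0 : ℝ)..ξ, φ x = ξ / 2 := by
  have h1 := intervalIntegral.integral_comp_sub_left (a := 0) (b := ξ) φ ξ
  rw [sub_self, sub_zero] at h1
  have hc := hφ.cont
  have h2 : ∫ x in (0 : ℝ)..ξ, (φ x + φ (ξ - x)) = ξ := by
    simp [truncSol_mass_add_reflect hk hev hb hM hξ hφ]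
  rw [intervalIntegral.integral_add (hc.intervalIntegrable _ _)
    (Continuous.intervalIntegrable (by fun_prop) _ _), h1] at h2
  linear_combination h2 / 2

/-- The product of the diagonal values of the solutions with right-hand sides `M` and `1`. -/
theorem truncSol_mass_mul_one {Φ Ψ : ℝ → ℝ → ℂ} (hk : Continuous k)
    (hev : ∀ x, k (-x) = k x) {C : ℝ} (hC : ∀ x, ‖k x‖ ≤ C) (hb : HasAprioriBound k)
    (hM : ∀ x, M x = 1 / 2 - ∫ s in (0 : ℝ)..x, k s) (hMc : Continuous M)
    (hΦ : ∀ ξ, 0 ≤ ξ → IsTruncSol k ξ M (Φ ξ))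
    (hΨ : ∀ ξ, 0 ≤ ξ → IsTruncSol k ξ (fun _ => 1) (Ψ ξ)) (hξ : 0 ≤ ξ) :
    Φ ξ ξ * Ψ ξ ξ = 1 / 2 := by
  -- The product is the derivative of `∫_0^ξ Φ_ξ`, which is known to be `ξ / 2`.
  have h1 := hasDerivWithinAt_integral_truncSol hk hev hC hb hMc continuous_const hΦ hΨ hξ
  have h2 : HasDerivWithinAt (fun ξ : ℝ => (ξ : ℂ) / 2) (1 / 2) (Ici 0) ξ :=
    (Complex.ofRealCLM.hasDerivAt.div_const 2).hasDerivWithinAt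
  refine (uniqueDiffOn_Ici (0 : ℝ) ξ hξ).eq_deriv _ (h1.congr_of_mem (fun η hη => ?_) hξ) h2
  simp [integral_truncSol_mass hk hev hb hM hη (hΦ η hη)]

theorem continuous_mass (hk : Continuous k) (hM : ∀ x, M x = 1 / 2 - ∫ s in (0 : ℝ)..x, k s) :
    Continuous M := by
  rw [funext hM]
  exact continuous_const.sub
    (intervalIntegral.continuous_primitive (fun a b => hk.intervalIntegrable a b) 0)

/-! ### Exponential right-hand sides. -/

/-- The commutation identity for the truncated operator, applied to an exponential. -/
theorem isTruncSol_exp_add_integral (hk : Continuous k) (hev : ∀ x, k (-x) = k x)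
    (hM : ∀ x, M x = 1 / 2 - ∫ s in (0 : ℝ)..x, k s) (z : ℂ)
    (hf : IsTruncSol k ξ (fun x => Complex.exp (Complex.I * z * x)) f) :
    IsTruncSol k ξ (fun x => (1 + Complex.I * z * ∫ t in (0 : ℝ)..ξ, f t * M t) +
        (Complex.I * z * ∫ t in (0 : ℝ)..ξ, f t) * M x)
      (fun x => f x + Complex.I * z * ∫ t in x..ξ, f t) := by
  have hfc := hf.cont
  have hMc := continuous_mass hk hM
  set κ : ℝ → ℂ := fun x => ∫ s in (0 : ℝ)..x, k s with hκ
  have hκc : Continuous κ :=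
    intervalIntegral.continuous_primitive (fun a b => hk.intervalIntegrable a b) 0
  have hFc : Continuous fun x => ∫ t in x..ξ, f t := by
    simp only [intervalIntegral.integral_symm ξ]
    exact (intervalIntegral.continuous_primitive (fun a b => hfc.intervalIntegrable a b) ξ).neg
  refine ⟨by fun_prop, fun x => ?_⟩
  -- integration by parts of the convolution with the primitive of `f`
  have hparts : ∫ t in (0 : ℝ)..ξ, k (x - t) * ∫ s in t..ξ, f s =
      κ x * (∫ t in (0 : ℝ)..ξ, f t) - ∫ t in (0 : ℝ)..ξ, f t * κ (x - t) := by
    have hu : ∀ t ∈ uIcc 0 ξ, HasDerivAt (fun t => ∫ s in t..ξ, f s) (-f t) t := fun t _ => by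
      simp only [intervalIntegral.integral_symm ξ]
      exact (hasDerivAt_integral_of_continuous hfc ξ t).neg
    have hv : ∀ t ∈ uIcc 0 ξ, HasDerivAt (fun t => -κ (x - t)) (k (x - t)) t := fun t _ => by
      have := ((hasDerivAt_integral_of_continuous hk 0 (x - t)).scomp t
        ((hasDerivAt_id t).const_sub x)).neg
      rw [neg_one_smul, neg_neg] at this
      exact this
    have := intervalIntegral.integral_mul_deriv_eq_deriv_mul hu hv
      (hfc.neg.intervalIntegrable _ _) (Continuous.intervalIntegrable (by fun_prop) _ _)
    simp only [intervalIntegral.integral_same, zero_mul, neg_mul, mul_neg,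
      neg_neg] at this
    simp only [mul_comm (k _)]
    rw [this, sub_zero x]
    ring
  -- Integrating the equation for `f` over `[0,x]` produces the same term `∫ f(t) κ(x - t) dt` that
  -- the integration by parts leaves, so the two cancel in the final identity.
  have hint : ∫ y in (0 : ℝ)..x, f y = (∫ y in (0 : ℝ)..x, Complex.exp (Complex.I * z * y)) +
      ((∫ t in (0 : ℝ)..ξ, f t * κ t) + ∫ t in (0 : ℝ)..ξ, f t * κ (x - t)) := by
    have h1 : ∫ y in (0 : ℝ)..x, ∫ t in (0 : ℝ)..ξ, k (y - t) * f t =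
        (∫ t in (0 : ℝ)..ξ, f t * κ t) + ∫ t in (0 : ℝ)..ξ, f t * κ (x - t) := by
      rw [integral_integral_swap_of_continuous (by fun_prop),
        ← intervalIntegral.integral_add (Continuous.intervalIntegrable (by fun_prop) _ _)
          (Continuous.intervalIntegrable (by fun_prop) _ _)]
      refine intervalIntegral.integral_congr fun t _ => ?_
      rw [intervalIntegral.integral_mul_const, ← mul_add, mul_comm]
      congr 1
      rw [← integral_sub_left_of_even hk hev]
      refine intervalIntegral.integral_congr fun y _ => ?_
      rw [← hev, neg_sub]
    have hkf : Continuous fun y => ∫ t in (0 : ℝ)..ξ, k (y - t) * f t := by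
      have : (fun y => ∫ t in (0 : ℝ)..ξ, k (y - t) * f t) =
          fun y : ℝ => f y - Complex.exp (Complex.I * z * y) := by
        funext y; rw [hf.eqn y]; ring
      rw [this]
      fun_prop
    rw [← h1, ← intervalIntegral.integral_add (Continuous.intervalIntegrable (by fun_prop) _ _)
      (hkf.intervalIntegrable _ _)]
    exact intervalIntegral.integral_congr fun y _ => hf.eqn y
  have hexp : Complex.exp (Complex.I * z * x) =
      1 + Complex.I * z * ∫ y in (0 : ℝ)..x, Complex.exp (Complex.I * z * y) := by
    have hd : ∀ y ∈ uIcc 0 x, HasDerivAt (fun y : ℝ => Complex.exp (Complex.I * z * y))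
        (Complex.I * z * Complex.exp (Complex.I * z * y)) y := fun y _ => by
      have := ((Complex.ofRealCLM.hasDerivAt (x := y)).const_mul (Complex.I * z)).cexp
      simpa [mul_comm] using this
    have := intervalIntegral.integral_eq_sub_of_hasDerivAt hd
      (Continuous.intervalIntegrable (by fun_prop) _ _)
    rw [intervalIntegral.integral_const_mul] at this
    rw [this]
    simp
  have hfM : ∫ t in (0 : ℝ)..ξ, f t * M t =
      1 / 2 * (∫ t in (0 : ℝ)..ξ, f t) - ∫ t in (0 : ℝ)..ξ, f t * κ t := by
    rw [← intervalIntegral.integral_const_mul, ← intervalIntegral.integral_sub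
      (Continuous.intervalIntegrable (by fun_prop) _ _)
      (Continuous.intervalIntegrable (by fun_prop) _ _)]
    refine intervalIntegral.integral_congr fun t _ => ?_
    rw [hM]
    ring
  have hsplit : (∫ t in (0 : ℝ)..x, f t) + ∫ t in x..ξ, f t = ∫ t in (0 : ℝ)..ξ, f t :=
    intervalIntegral.integral_add_adjacent_intervals (hfc.intervalIntegrable _ _)
      (hfc.intervalIntegrable _ _)
  have hconv : ∫ t in (0 : ℝ)..ξ, k (x - t) * (f t + Complex.I * z * ∫ s in t..ξ, f s) =
      (∫ t in (0 : ℝ)..ξ, k (x - t) * f t) +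
        Complex.I * z * ∫ t in (0 : ℝ)..ξ, k (x - t) * ∫ s in t..ξ, f s := by
    rw [← intervalIntegral.integral_const_mul, ← intervalIntegral.integral_add
      (Continuous.intervalIntegrable (by fun_prop) _ _)
      (Continuous.intervalIntegrable (by fun_prop) _ _)]
    refine intervalIntegral.integral_congr fun t _ => ?_
    ring
  rw [hconv, hparts, hfM, hM x, hf.eqn x, hexp]
  linear_combination (Complex.I * z) * hsplit - (Complex.I * z) * hint

/-- The diagonal value of the solution with exponential right-hand side. -/
theorem truncSol_exp_diagonal (hk : Continuous k) (hev : ∀ x, k (-x) = k x)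
    (hb : HasAprioriBound k) (hM : ∀ x, M x = 1 / 2 - ∫ s in (0 : ℝ)..x, k s) (z : ℂ) (hξ : 0 ≤ ξ)
    (hf : IsTruncSol k ξ (fun x => Complex.exp (Complex.I * z * x)) f)
    (hφ : IsTruncSol k ξ (fun _ => 1) φ) (hψ : IsTruncSol k ξ M ψ) :
    f ξ = (1 + Complex.I * z * ∫ t in (0 : ℝ)..ξ, f t * M t) * φ ξ +
      (Complex.I * z * ∫ t in (0 : ℝ)..ξ, f t) * ψ ξ := by
  have h1 := isTruncSol_exp_add_integral hk hev hM z hf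
  have h2 := (hφ.const_mul (1 + Complex.I * z * ∫ t in (0 : ℝ)..ξ, f t * M t)).add hk
    (hψ.const_mul (Complex.I * z * ∫ t in (0 : ℝ)..ξ, f t))
  simp only [mul_one] at h2
  simpa using congrFun (h1.unique hk hb hξ h2) ξ

end

/-! ### Uniqueness for planar linear systems -/

/-- Uniqueness by Grönwall needs only a Lipschitz constant in the state, uniform in time. Bounded
coefficients therefore suffice, and continuity of `q₁` and `q₂` need not be established. -/
theorem planar_linear_ode_unique {a b c d : ℝ → ℂ} {T m : ℝ} (ha : ∀ t ∈ Icc 0 T, ‖a t‖ ≤ m)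
    (hb : ∀ t ∈ Icc 0 T, ‖b t‖ ≤ m) (hc : ∀ t ∈ Icc 0 T, ‖c t‖ ≤ m)
    (hd : ∀ t ∈ Icc 0 T, ‖d t‖ ≤ m) {u₁ u₂ v₁ v₂ : ℝ → ℂ}
    (hu₁ : ∀ t, 0 ≤ t → HasDerivWithinAt u₁ (a t * u₁ t + b t * u₂ t) (Ici 0) t)
    (hu₂ : ∀ t, 0 ≤ t → HasDerivWithinAt u₂ (c t * u₁ t + d t * u₂ t) (Ici 0) t)
    (hv₁ : ∀ t, 0 ≤ t → HasDerivWithinAt v₁ (a t * v₁ t + b t * v₂ t) (Ici 0) t)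
    (hv₂ : ∀ t, 0 ≤ t → HasDerivWithinAt v₂ (c t * v₁ t + d t * v₂ t) (Ici 0) t)
    (h₁ : u₁ 0 = v₁ 0) (h₂ : u₂ 0 = v₂ 0) (hT : 0 ≤ T) : u₁ T = v₁ T := by
  have hm : 0 ≤ m := (norm_nonneg _).trans (ha 0 ⟨le_rfl, hT⟩)
  have hcoef : ∀ (p q : ℂ), ‖p‖ ≤ m → ‖q‖ ≤ m → ∀ x y : ℂ × ℂ,
      ‖(p * x.1 + q * x.2) - (p * y.1 + q * y.2)‖ ≤ 2 * m * ‖x - y‖ := fun p q hp hq x y => by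
    have e : (p * x.1 + q * x.2) - (p * y.1 + q * y.2) = p * (x - y).1 + q * (x - y).2 := by
      simp only [Prod.fst_sub, Prod.snd_sub]; ring
    rw [e]
    refine (norm_add_le _ _).trans ?_
    rw [norm_mul, norm_mul, mul_assoc, two_mul]
    exact add_le_add (mul_le_mul hp (norm_fst_le _) (norm_nonneg _) hm)
      (mul_le_mul hq (norm_snd_le _) (norm_nonneg _) hm)
  have key := ODE_solution_unique_of_mem_Icc_right (E := ℂ × ℂ) (a := 0) (b := T)
    (K := ⟨2 * m, by positivity⟩) (s := fun _ => univ)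
    (v := fun t x => (a t * x.1 + b t * x.2, c t * x.1 + d t * x.2))
    (f := fun t => (u₁ t, u₂ t)) (g := fun t => (v₁ t, v₂ t))
    (fun t ht => by
      have ht' : t ∈ Icc 0 T := Ico_subset_Icc_self ht
      refine LipschitzOnWith.of_dist_le_mul fun x _ y _ => ?_
      rw [dist_eq_norm, dist_eq_norm, Prod.norm_def]
      exact max_le (hcoef _ _ (ha t ht') (hb t ht') x y) (hcoef _ _ (hc t ht') (hd t ht') x y))
    (fun t ht => ((hu₁ t ht.1).prodMk (hu₂ t ht.1)).continuousWithinAt.mono Icc_subset_Ici_self)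
    (fun t ht => ((hu₁ t ht.1).prodMk (hu₂ t ht.1)).mono (Ici_subset_Ici.2 ht.1))
    (fun _ _ => mem_univ _)
    (fun t ht => ((hv₁ t ht.1).prodMk (hv₂ t ht.1)).continuousWithinAt.mono Icc_subset_Ici_self)
    (fun t ht => ((hv₁ t ht.1).prodMk (hv₂ t ht.1)).mono (Ici_subset_Ici.2 ht.1))
    (fun _ _ => mem_univ _) (by simp [h₁, h₂])
  exact congrArg Prod.fst (key ⟨hT, le_rfl⟩)

/-! ### The truncated equations for the convolution kernel -/

section
variable {ρ : ℝ → ℝ} {U μ : ℝ} {ξ : ℝ} {g φ : ℝ → ℂ}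

theorem kernel_neg (heven : ∀ l, ρ (-l) = ρ l) (x : ℝ) : kernel ρ (-x) = kernel ρ x := by
  rw [kernel, kernel]
  congr 1
  rw [← integral_neg_eq_self]
  refine integral_congr_ae (ae_of_all _ fun l => ?_)
  simp [heven]

/-- The kernel `μ h` of the integral equations. -/
noncomputable def scaledKernel (ρ : ℝ → ℝ) (μ x : ℝ) : ℂ := (μ : ℂ) * kernel ρ x

theorem continuous_scaledKernel (hi : Integrable ρ) : Continuous (scaledKernel ρ μ) :=
  continuous_const.mul (continuous_kernel hi)

theorem scaledKernel_neg (heven : ∀ l, ρ (-l) = ρ l) (x : ℝ) :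
    scaledKernel ρ μ (-x) = scaledKernel ρ μ x := by
  rw [scaledKernel, scaledKernel, kernel_neg heven]

theorem conj_scaledKernel (heven : ∀ l, ρ (-l) = ρ l) (x : ℝ) :
    (starRingEnd ℂ) (scaledKernel ρ μ x) = scaledKernel ρ μ x := by
  rw [scaledKernel, map_mul, conj_kernel, kernel_neg heven, Complex.conj_ofReal]

theorem norm_scaledKernel_le (ρ : ℝ → ℝ) (μ : ℝ) : ∃ C, ∀ x, ‖scaledKernel ρ μ x‖ ≤ C := by
  obtain ⟨C, -, hC⟩ := norm_kernel_le ρ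
  refine ⟨‖(μ : ℂ)‖ * C, fun x => ?_⟩
  rw [scaledKernel, norm_mul]
  exact mul_le_mul_of_nonneg_left (hC x) (norm_nonneg _)

theorem massM_eq (ρ : ℝ → ℝ) (μ x : ℝ) :
    massM ρ μ x = 1 / 2 - ∫ s in (0 : ℝ)..x, scaledKernel ρ μ s := by
  simp only [massM, scaledKernel, intervalIntegral.integral_const_mul]

/-! ### `L²` estimates and the a priori bound. -/

theorem opS_apply_ae (hb : ∀ l, |ρ l| ≤ U) (hi : Integrable ρ) {A : Set ℝ} (hA : MeasurableSet A)
    (f : L2 A) : opS ρ μ A f =ᵐ[volume.restrict A]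
      fun x => f x - ∫ t in A, scaledKernel ρ μ (x - t) * f t := by
  have h := (convolutionOperator_spec hb hi hA).1 f
  rw [opS, sub_apply, one_apply_eq_self, smul_apply]
  filter_upwards [Lp.coeFn_sub f ((μ : ℂ) • convolutionOperator ρ A f),
    Lp.coeFn_smul (μ : ℂ) (convolutionOperator ρ A f), h] with x h1 h2 h3
  rw [h1, Pi.sub_apply, h2, Pi.smul_apply, h3, smul_eq_mul, ← integral_const_mul]
  simp only [scaledKernel, mul_assoc]

/-- The convolution operator has norm at most `U` whatever the set `A`, so this lower bound is
uniform in the interval length. -/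
theorem le_norm_opS_apply (hb : ∀ l, |ρ l| ≤ U) (hi : Integrable ρ) {A : Set ℝ}
    (hA : MeasurableSet A) (f : L2 A) : (1 - |μ| * U) * ‖f‖ ≤ ‖opS ρ μ A f‖ := by
  rw [opS, sub_apply, one_apply_eq_self, smul_apply]
  have h1 := norm_sub_norm_le f ((μ : ℂ) • convolutionOperator ρ A f)
  have h2 : ‖(μ : ℂ) • convolutionOperator ρ A f‖ ≤ |μ| * (U * ‖f‖) := by
    rw [norm_smul, Complex.norm_real, Real.norm_eq_abs]
    exact mul_le_mul_of_nonneg_left ((convolutionOperator ρ A).le_of_opNorm_le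
      (convolutionOperator_spec hb hi hA).2 f) (abs_nonneg μ)
  linarith

theorem memLp_Ioo_of_continuous (hφ : Continuous φ) :
    MemLp φ 2 (volume.restrict (Ioo 0 ξ)) := by
  obtain ⟨C, hC⟩ := (isCompact_Icc (a := (0 : ℝ)) (b := ξ)).exists_bound_of_continuousOn
    hφ.continuousOn
  have : IsFiniteMeasure (volume.restrict (Ioo 0 ξ)) := ⟨by simp⟩
  refine MemLp.of_bound hφ.aestronglyMeasurable C ?_
  exact (ae_restrict_iff' measurableSet_Ioo).2 (ae_of_all _ fun t ht => hC t (Ioo_subset_Icc_self ht))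

theorem norm_toLp_Ioo_le (hξ : 0 ≤ ξ) (hφ : MemLp φ 2 (volume.restrict (Ioo 0 ξ))) {C : ℝ}
    (hC0 : 0 ≤ C) (hC : ∀ x ∈ Ioo 0 ξ, ‖φ x‖ ≤ C) : ‖hφ.toLp φ‖ ≤ √ξ * C := by
  have : IsFiniteMeasure (volume.restrict (Ioo 0 ξ)) := ⟨by simp⟩
  refine (Lp.norm_le_of_ae_bound hC0 ?_).trans (le_of_eq ?_)
  · filter_upwards [hφ.coeFn_toLp, ae_restrict_mem measurableSet_Ioo] with x h1 h2
    rw [h1]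
    exact hC x h2
  · congr 1
    rw [Real.sqrt_eq_rpow]
    simp [measureUnivNNReal, ENNReal.coe_toNNReal_eq_toReal, ENNReal.toReal_ofReal, hξ]

/-- Cauchy–Schwarz for the bilinear pairing, obtained by conjugating one factor, which does not
change its norm. -/
theorem norm_integral_mul_le {A : Set ℝ} {ψ : ℝ → ℂ} (hψ : MemLp ψ 2 (volume.restrict A))
    (hφ : MemLp φ 2 (volume.restrict A)) :
    ‖∫ x in A, ψ x * φ x‖ ≤ ‖hψ.toLp ψ‖ * ‖hφ.toLp φ‖ := by
  have hs := hψ.star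
  have h1 : ∫ x in A, ψ x * φ x = ⟪hs.toLp _, hφ.toLp φ⟫_ℂ := by
    rw [L2.inner_def]
    refine integral_congr_ae ?_
    filter_upwards [hs.coeFn_toLp, hφ.coeFn_toLp] with x h1 h2
    rw [h1, h2, RCLike.inner_apply]
    simp [mul_comm]
  have h2 : ‖hs.toLp _‖ = ‖hψ.toLp ψ‖ := by
    rw [Lp.norm_toLp, Lp.norm_toLp]
    congr 1
    refine eLpNorm_congr_norm_ae (ae_of_all _ fun x => ?_)
    simp
  rw [h1, ← h2]
  exact norm_inner_le_norm _ _

theorem intervalIntegral_eq_integral_Ioo (hξ : 0 ≤ ξ) (f : ℝ → ℂ) :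
    ∫ t in (0 : ℝ)..ξ, f t = ∫ t in Ioo 0 ξ, f t := by
  rw [intervalIntegral.integral_of_le hξ, integral_Ioc_eq_integral_Ioo]

theorem opS_toLp_ae (hb : ∀ l, |ρ l| ≤ U) (hi : Integrable ρ) (hξ : 0 ≤ ξ)
    (hφ : MemLp φ 2 (volume.restrict (Ioo 0 ξ))) :
    truncS ρ μ ξ (hφ.toLp φ) =ᵐ[volume.restrict (Ioo 0 ξ)]
      fun x => φ x - ∫ t in (0 : ℝ)..ξ, scaledKernel ρ μ (x - t) * φ t := by
  filter_upwards [opS_apply_ae (μ := μ) hb hi measurableSet_Ioo (hφ.toLp φ), hφ.coeFn_toLp]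
    with x h1 h2
  rw [h1, h2, intervalIntegral_eq_integral_Ioo hξ]
  congr 1
  refine integral_congr_ae ?_
  filter_upwards [hφ.coeFn_toLp] with t ht
  rw [ht]

theorem IsTruncSol.opS_toLp (hb : ∀ l, |ρ l| ≤ U) (hi : Integrable ρ) (hξ : 0 ≤ ξ)
    (hφ : IsTruncSol (scaledKernel ρ μ) ξ g φ) (hφ2 : MemLp φ 2 (volume.restrict (Ioo 0 ξ)))
    (hg2 : MemLp g 2 (volume.restrict (Ioo 0 ξ))) :
    truncS ρ μ ξ (hφ2.toLp φ) = hg2.toLp g := by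
  refine Lp.ext ?_
  filter_upwards [opS_toLp_ae (μ := μ) hb hi hξ hφ2, hg2.coeFn_toLp] with x h1 h2
  rw [h1, h2, hφ.eqn x]
  ring

/-- Coercivity bounds the solution in `L²`; Cauchy–Schwarz against the bounded slice `t ↦ k(x - t)`
converts this into a pointwise bound for every real `x`. -/
theorem hasAprioriBound_scaledKernel (hb : ∀ l, |ρ l| ≤ U) (hi : Integrable ρ)
    (hμ : |μ| * U < 1) : HasAprioriBound (scaledKernel ρ μ) := by
  intro b
  obtain ⟨C, hC⟩ := norm_scaledKernel_le ρ μ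
  have hC0 : 0 ≤ C := (norm_nonneg _).trans (hC 0)
  have hκ : 0 < 1 - |μ| * U := by linarith
  refine ⟨C * (|b| / (1 - |μ| * U)), by positivity, fun ξ hξ g φ m hφ hg x => ?_⟩
  have hξ0 := hξ.1
  have hkc : Continuous (scaledKernel ρ μ) := continuous_scaledKernel hi
  have hφc := hφ.cont
  have hgc : Continuous g := by
    have e : g = fun x => φ x - ∫ t in (0 : ℝ)..ξ, scaledKernel ρ μ (x - t) * φ t := by
      funext x; rw [hφ.eqn x]; ring
    rw [e]
    exact hφc.sub (intervalIntegral.continuous_parametric_intervalIntegral_of_continuous'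
      (by fun_prop) _ _)
  have hm : 0 ≤ m := (norm_nonneg _).trans (hg 0 ⟨le_rfl, hξ0⟩)
  have hφ2 := memLp_Ioo_of_continuous (ξ := ξ) hφc
  have hg2 := memLp_Ioo_of_continuous (ξ := ξ) hgc
  have hk2 : MemLp (fun t => scaledKernel ρ μ (x - t)) 2 (volume.restrict (Ioo 0 ξ)) :=
    memLp_Ioo_of_continuous (by fun_prop)
  have h1 := le_norm_opS_apply (μ := μ) hb hi measurableSet_Ioo (hφ2.toLp φ)
  rw [hφ.opS_toLp hb hi hξ0 hφ2 hg2] at h1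
  have h2 := norm_toLp_Ioo_le hξ0 hg2 hm fun x hx => hg x (Ioo_subset_Icc_self hx)
  have h3 := norm_toLp_Ioo_le hξ0 hk2 hC0 fun t _ => hC (x - t)
  have h4 := norm_integral_mul_le hk2 hφ2
  have h5 : ‖hφ2.toLp φ‖ ≤ √ξ * m / (1 - |μ| * U) := by
    rw [le_div_iff₀ hκ]
    linarith
  rw [hφ.eqn x, intervalIntegral_eq_integral_Ioo hξ0]
  refine (norm_add_le _ _).trans (add_le_add_right ?_ _)
  -- One `√ξ` comes from the `L²` norm of the kernel slice, the other from that of `g`; their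
  -- product is `ξ ≤ |b|`.
  calc _ ≤ (√ξ * C) * (√ξ * m / (1 - |μ| * U)) :=
        h4.trans (mul_le_mul h3 h5 (norm_nonneg _) (by positivity))
    _ = C * (ξ / (1 - |μ| * U)) * m := by
        have := Real.mul_self_sqrt hξ0
        linear_combination (C * m / (1 - |μ| * U)) * this
    _ ≤ _ := by
        gcongr
        exact hξ.2.trans (le_abs_self b)

/-! ### Solutions given by the resolvent kernel. -/

/-- The solution of the truncated equation given by the resolvent kernel. -/
noncomputable def truncSol (ρ : ℝ → ℝ) (μ : ℝ) (g : ℝ → ℂ) (ξ x : ℝ) : ℂ :=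
  g x + ∫ t in (0 : ℝ)..ξ, scaledKernel ρ μ (x - t) *
    (g t + ∫ s in (0 : ℝ)..ξ, resolventKernel ρ μ ξ t s * g s)

/-- The resolvent formula inverts `S_ξ` only as an identity in `L²`. Both sides are continuous on
`[0,ξ]`, so almost everywhere equality upgrades to equality at every point, including the endpoint
`ξ` where `q₁` and `q₂` are read off. -/
theorem truncSol_eq_of_mem (hb : ∀ l, |ρ l| ≤ U) (hi : Integrable ρ) (hμ : |μ| * U < 1)
    (hg : Continuous g) (hξ : 0 ≤ ξ) :
    Continuous (truncSol ρ μ g ξ) ∧ ∀ x ∈ Icc 0 ξ, truncSol ρ μ g ξ x =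
      g x + ∫ s in (0 : ℝ)..ξ, resolventKernel ρ μ ξ x s * g s := by
  have hkc : Continuous (scaledKernel ρ μ) := continuous_scaledKernel hi
  obtain ⟨hRc, hR⟩ := resolventKernel_spec hb hi hμ ξ
  set R := resolventKernel ρ μ ξ with hRdef
  -- The resolvent kernel is controlled only on the square `[0,ξ]²`; clamping both arguments extends
  -- it continuously to the plane without changing it there.
  let p : ℝ → ℝ := fun x => projIcc 0 ξ hξ x
  have hpc : Continuous p := continuous_subtype_val.comp continuous_projIcc
  have hp : ∀ x ∈ Icc 0 ξ, p x = x := fun x hx => by simp [p, projIcc_of_mem hξ hx]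
  have hKc : Continuous (Function.uncurry fun x t => R (p x) (p t)) :=
    hRc.comp_continuous (f := fun q : ℝ × ℝ => (p q.1, p q.2)) (by fun_prop)
      fun q => ⟨Subtype.coe_prop _, Subtype.coe_prop _⟩
  let u : ℝ → ℂ := fun x => g x + ∫ s in (0 : ℝ)..ξ, R (p x) (p s) * g s
  have huc : Continuous u :=
    hg.add (intervalIntegral.continuous_parametric_intervalIntegral_of_continuous'
      (hKc.mul (hg.comp continuous_snd)) _ _)
  have hu : ∀ x ∈ Icc 0 ξ, u x = g x + ∫ s in (0 : ℝ)..ξ, R x s * g s := fun x hx => by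
    simp only [u]
    congr 1
    refine intervalIntegral.integral_congr fun s hs => ?_
    rw [uIcc_of_le hξ] at hs
    simp only [hp x hx, hp s hs]
  have hT : truncSol ρ μ g ξ = fun x => g x + ∫ t in (0 : ℝ)..ξ, scaledKernel ρ μ (x - t) * u t := by
    funext x
    rw [truncSol]
    congr 1
    refine intervalIntegral.integral_congr fun t ht => ?_
    rw [uIcc_of_le hξ] at ht
    simp only [hu t ht, hRdef]
  have hTc : Continuous (truncSol ρ μ g ξ) := by
    rw [hT]
    exact hg.add (intervalIntegral.continuous_parametric_intervalIntegral_of_continuous'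
      (by fun_prop) _ _)
  refine ⟨hTc, fun x hx => ?_⟩
  rw [← hu x hx]
  -- Almost everywhere equality carries no information on the degenerate interval, so `ξ = 0` is
  -- checked directly.
  rcases hξ.eq_or_lt with rfl | hpos
  · rw [hT]; simp [u]
  have hg2 := memLp_Ioo_of_continuous (ξ := ξ) hg
  have hu2 := memLp_Ioo_of_continuous (ξ := ξ) huc
  have hinv : (truncS ρ μ ξ).inverse (hg2.toLp g) = hu2.toLp u := by
    refine Lp.ext ?_
    filter_upwards [hR (hg2.toLp g), hg2.coeFn_toLp, hu2.coeFn_toLp,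
      ae_restrict_mem measurableSet_Ioo] with x h1 h2 h3 h4
    rw [h1, h2, h3, hu x (Ioo_subset_Icc_self h4), intervalIntegral_eq_integral_Ioo hξ]
    congr 1
    refine integral_congr_ae ?_
    filter_upwards [hg2.coeFn_toLp] with t ht
    rw [ht]
  have hS : truncS ρ μ ξ (hu2.toLp u) = hg2.toLp g := by
    rw [← hinv]
    exact (isInvertible_opS hb hi hμ measurableSet_Ioo).self_apply_inverse _
  have hae : truncSol ρ μ g ξ =ᵐ[volume.restrict (Icc 0 ξ)] u := by
    rw [← Measure.restrict_congr_set Ioo_ae_eq_Icc]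
    have h := opS_toLp_ae (μ := μ) hb hi hξ hu2
    rw [hS] at h
    filter_upwards [h, hg2.coeFn_toLp] with x h1 h2
    rw [hT]
    simp only
    rw [← h2, h1]
    ring
  exact Measure.eqOn_Icc_of_ae_eq volume hpos.ne hae hTc.continuousOn huc.continuousOn hx

theorem isTruncSol_truncSol (hb : ∀ l, |ρ l| ≤ U) (hi : Integrable ρ) (hμ : |μ| * U < 1)
    (hg : Continuous g) (hξ : 0 ≤ ξ) :
    IsTruncSol (scaledKernel ρ μ) ξ g (truncSol ρ μ g ξ) := by
  obtain ⟨h1, h2⟩ := truncSol_eq_of_mem hb hi hμ hg hξ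
  refine ⟨h1, fun x => ?_⟩
  conv_lhs => rw [truncSol]
  congr 1
  refine intervalIntegral.integral_congr fun t ht => ?_
  rw [uIcc_of_le hξ] at ht
  simp only [h2 t ht]

theorem truncSol_one_diagonal (hb : ∀ l, |ρ l| ≤ U) (hi : Integrable ρ) (hμ : |μ| * U < 1)
    (hξ : 0 ≤ ξ) : truncSol ρ μ (fun _ => 1) ξ ξ = q₁ ρ μ ξ := by
  rw [(truncSol_eq_of_mem hb hi hμ continuous_const hξ).2 ξ ⟨hξ, le_rfl⟩, q₁]
  simp only [mul_one]

theorem continuous_massM (hi : Integrable ρ) : Continuous (massM ρ μ) :=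
  continuous_mass (continuous_scaledKernel hi) (massM_eq ρ μ)

theorem truncSol_mass_diagonal (hb : ∀ l, |ρ l| ≤ U) (hi : Integrable ρ) (hμ : |μ| * U < 1)
    (hξ : 0 ≤ ξ) : truncSol ρ μ (massM ρ μ) ξ ξ = q₂ ρ μ ξ := by
  rw [(truncSol_eq_of_mem hb hi hμ (continuous_massM hi) hξ).2 ξ ⟨hξ, le_rfl⟩, q₂]
  simp only [mul_comm]

theorem exists_bound_truncSol_diagonal (hb : ∀ l, |ρ l| ≤ U) (hi : Integrable ρ)
    (hμ : |μ| * U < 1) (hg : Continuous g) (T : ℝ) :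
    ∃ m, ∀ ξ ∈ Icc 0 T, ‖truncSol ρ μ g ξ ξ‖ ≤ m := by
  obtain ⟨c, hc0, hc⟩ := hasAprioriBound_scaledKernel hb hi hμ T
  obtain ⟨m, hm⟩ := (isCompact_Icc (a := (0 : ℝ)) (b := T)).exists_bound_of_continuousOn
    hg.continuousOn
  refine ⟨m + c * m, fun ξ hξ => ?_⟩
  have := hc ξ hξ g _ m (isTruncSol_truncSol hb hi hμ hg hξ.1)
    (fun x hx => hm x ⟨hx.1, hx.2.trans hξ.2⟩) ξ
  linarith [hm ξ hξ]

/-! ### The entry `w₁₂` of the canonical solution -/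

/-- The second column of `W` is `(y₁, y₂)`. With `f` the solution for the exponential, the
derivatives are `iz f(ξ) q₁` and `iz f(ξ) q₂`; inserting `f(ξ) = y₂ q₁ + y₁ q₂` and `q₁ q₂ = 1/2`
gives exactly the rows of `iz J H`. Symmetry of `S_ξ` finally moves the inverse from the exponential
to `1`. -/
theorem canonicalSolution_entry (hb : ∀ l, |ρ l| ≤ U) (heven : ∀ l, ρ (-l) = ρ l)
    (hi : Integrable ρ) (hμ : |μ| * U < 1) {W : ℝ → ℂ → Matrix (Fin 2) (Fin 2) ℂ}
    (hW : IsCanonicalSolution ρ μ W) (z : ℂ) (hξ : 0 ≤ ξ) :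
    W ξ z 0 1 = Complex.I * z *
      ∫ x in (0 : ℝ)..ξ, Complex.exp (Complex.I * z * x) * truncSol ρ μ (fun _ => 1) ξ x := by
  have hk : Continuous (scaledKernel ρ μ) := continuous_scaledKernel hi
  have hev := scaledKernel_neg (μ := μ) heven
  have hap := hasAprioriBound_scaledKernel hb hi hμ
  obtain ⟨C, hC⟩ := norm_scaledKernel_le ρ μ
  have hM := massM_eq ρ μ
  have hMc : Continuous (massM ρ μ) := continuous_massM hi
  set E : ℝ → ℂ := fun x => Complex.exp (Complex.I * z * x) with hE
  have hEc : Continuous E := by fun_prop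
  have hone : Continuous fun _ : ℝ => (1 : ℂ) := continuous_const
  have sE : ∀ ξ, 0 ≤ ξ → IsTruncSol (scaledKernel ρ μ) ξ E (truncSol ρ μ E ξ) :=
    fun ξ hξ => isTruncSol_truncSol hb hi hμ hEc hξ
  have s1 : ∀ ξ, 0 ≤ ξ → IsTruncSol (scaledKernel ρ μ) ξ (fun _ => 1)
      (truncSol ρ μ (fun _ => 1) ξ) := fun ξ hξ => isTruncSol_truncSol hb hi hμ hone hξ
  have sM : ∀ ξ, 0 ≤ ξ → IsTruncSol (scaledKernel ρ μ) ξ (massM ρ μ)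
      (truncSol ρ μ (massM ρ μ) ξ) := fun ξ hξ => isTruncSol_truncSol hb hi hμ hMc hξ
  set y₁ : ℝ → ℂ := fun ξ => Complex.I * z * ∫ x in (0 : ℝ)..ξ, truncSol ρ μ E ξ x * 1 with hy₁
  set y₂ : ℝ → ℂ := fun ξ =>
    1 + Complex.I * z * ∫ x in (0 : ℝ)..ξ, truncSol ρ μ E ξ x * massM ρ μ x with hy₂
  have hdiag : ∀ t, 0 ≤ t → truncSol ρ μ E t t = y₂ t * q₁ ρ μ t + y₁ t * q₂ ρ μ t := by
    intro t ht
    have := truncSol_exp_diagonal hk hev hap hM z ht (sE t ht) (s1 t ht) (sM t ht)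
    rw [truncSol_one_diagonal hb hi hμ ht, truncSol_mass_diagonal hb hi hμ ht] at this
    simpa only [hy₁, hy₂, mul_one] using this
  have hqq : ∀ t, 0 ≤ t → q₂ ρ μ t * q₁ ρ μ t = 1 / 2 := by
    intro t ht
    have := truncSol_mass_mul_one hk hev hC hap hM hMc sM s1 ht
    rwa [truncSol_one_diagonal hb hi hμ ht, truncSol_mass_diagonal hb hi hμ ht] at this
  have hy₁' : ∀ t, 0 ≤ t → HasDerivWithinAt y₁
      (Complex.I * z * (1 / 2) * y₁ t + Complex.I * z * q₁ ρ μ t ^ 2 * y₂ t) (Ici 0) t := by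
    intro t ht
    have h := (hasDerivWithinAt_integral_truncSol hk hev hC hap hEc hone sE s1 ht).const_mul
      (Complex.I * z)
    rw [truncSol_one_diagonal hb hi hμ ht, hdiag t ht] at h
    refine h.congr_deriv ?_
    linear_combination (Complex.I * z * y₁ t) * hqq t ht
  have hy₂' : ∀ t, 0 ≤ t → HasDerivWithinAt y₂
      (Complex.I * z * q₂ ρ μ t ^ 2 * y₁ t + Complex.I * z * (1 / 2) * y₂ t) (Ici 0) t := by
    intro t ht
    have h := ((hasDerivWithinAt_integral_truncSol hk hev hC hap hEc hMc sE sM ht).const_mul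
      (Complex.I * z)).const_add 1
    rw [truncSol_mass_diagonal hb hi hμ ht, hdiag t ht] at h
    refine h.congr_deriv ?_
    linear_combination (Complex.I * z * y₂ t) * hqq t ht
  obtain ⟨hW0, hW'⟩ := hW z
  obtain ⟨m₁, hm₁⟩ := exists_bound_truncSol_diagonal hb hi hμ hone ξ
  obtain ⟨m₂, hm₂⟩ := exists_bound_truncSol_diagonal hb hi hμ hMc ξ
  have hb1 : ∀ t ∈ Icc 0 ξ, ‖q₁ ρ μ t‖ ≤ max m₁ m₂ := fun t ht => by
    rw [← truncSol_one_diagonal hb hi hμ ht.1]; exact (hm₁ t ht).trans (le_max_left _ _)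
  have hb2 : ∀ t ∈ Icc 0 ξ, ‖q₂ ρ μ t‖ ≤ max m₁ m₂ := fun t ht => by
    rw [← truncSol_mass_diagonal hb hi hμ ht.1]; exact (hm₂ t ht).trans (le_max_right _ _)
  set m := max (‖Complex.I * z * (1 / 2)‖) (‖Complex.I * z‖ * max m₁ m₂ ^ 2) with hm
  have hsq : ∀ c : ℂ, ‖c‖ ≤ max m₁ m₂ → ‖Complex.I * z * c ^ 2‖ ≤ m := fun c hc => by
    rw [norm_mul, norm_pow]
    exact (mul_le_mul_of_nonneg_left (pow_le_pow_left₀ (norm_nonneg _) hc 2)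
      (norm_nonneg _)).trans (le_max_right _ _)
  have hu : W ξ z 0 1 = y₁ ξ := planar_linear_ode_unique (T := ξ) (m := m)
    (a := fun _ => Complex.I * z * (1 / 2)) (b := fun t => Complex.I * z * q₁ ρ μ t ^ 2)
    (c := fun t => Complex.I * z * q₂ ρ μ t ^ 2) (d := fun _ => Complex.I * z * (1 / 2))
    (u₁ := fun t => W t z 0 1) (u₂ := fun t => W t z 1 1) (v₁ := y₁) (v₂ := y₂)
    (fun _ _ => le_max_left _ _) (fun t ht => hsq _ (hb1 t ht)) (fun t ht => hsq _ (hb2 t ht))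
    (fun _ _ => le_max_left _ _)
    (fun t ht => (hW' t ht 0 1).congr_deriv (by
      simp [matJ, hamiltonian, Matrix.vecMul, dotProduct]; ring))
    (fun t ht => (hW' t ht 1 1).congr_deriv (by
      simp [matJ, hamiltonian, Matrix.vecMul, dotProduct]; ring))
    hy₁' hy₂' (by simp [hW0, hy₁]) (by simp [hW0, hy₂]) hξ
  rw [hu]
  simp only [hy₁]
  rw [(sE ξ hξ).integral_mul_comm hk hev hEc hone (s1 ξ hξ)]
  exact congrArg _ (intervalIntegral.integral_congr fun x _ => mul_comm _ _)

end
/-! ### Convergence of the finite sections -/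

section
variable {ρ : ℝ → ℝ} {U μ : ℝ} {ξ : ℝ} {g φ : ℝ → ℂ}

/-- Dominated convergence to zero in `L²(A)`. -/
theorem tendsto_zero_of_dominated {A : Set ℝ} {F : ℝ → L2 A} (r : L2 A) (G : ℝ → ℝ → ℂ)
    (hG : ∀ ξ, F ξ =ᵐ[volume.restrict A] G ξ) (hle : ∀ ξ x, ‖G ξ x‖ ≤ ‖r x‖)
    (hlim : ∀ x, Tendsto (fun ξ => G ξ x) atTop (𝓝 0)) : Tendsto F atTop (𝓝 0) := by
  have hsq : ∀ ξ, ((‖F ξ‖ ^ 2 : ℝ) : ℂ) = ∫ x in A, ((‖G ξ x‖ ^ 2 : ℝ) : ℂ) := fun ξ => by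
    have h := inner_self_eq_norm_sq_to_K (𝕜 := ℂ) (F ξ)
    rw [L2.inner_def] at h
    push_cast
    refine h.symm.trans (integral_congr_ae ?_)
    filter_upwards [hG ξ] with x hx
    rw [inner_self_eq_norm_sq_to_K, hx]
    rfl
  have h0 : Tendsto (fun ξ => ∫ x in A, ((‖G ξ x‖ ^ 2 : ℝ) : ℂ)) atTop (𝓝 (∫ x in A, (0 : ℂ))) := by
    refine tendsto_integral_filter_of_dominated_convergence (fun x => ‖r x‖ ^ 2) ?_ ?_ ?_ ?_
    · refine Eventually.of_forall fun ξ => ?_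
      have : AEStronglyMeasurable (G ξ) (volume.restrict A) :=
        (Lp.aestronglyMeasurable (F ξ)).congr (hG ξ)
      exact Complex.continuous_ofReal.comp_aestronglyMeasurable (this.norm.pow 2)
    · refine Eventually.of_forall fun ξ => ae_of_all _ fun x => ?_
      rw [Complex.norm_real, norm_pow, norm_norm]
      exact pow_le_pow_left₀ (norm_nonneg _) (hle ξ x) 2
    · exact (memLp_two_iff_integrable_sq_norm (Lp.aestronglyMeasurable r)).1 (Lp.memLp r)
    · refine ae_of_all _ fun x => ?_
      have := ((hlim x).norm.pow 2).ofReal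
      simpa using this
  rw [integral_zero] at h0
  rw [tendsto_zero_iff_norm_tendsto_zero]
  have h1 : Tendsto (fun ξ => ‖F ξ‖ ^ 2) atTop (𝓝 0) := by
    have := h0.norm
    simp only [← hsq, Complex.norm_real, norm_zero, norm_pow, norm_norm] at this
    exact this
  have := h1.sqrt
  simpa [Real.sqrt_sq] using this

theorem projP_apply_ae (A : Set ℝ) (ξ : ℝ) (f : L2 A) :
    projP A ξ f =ᵐ[volume.restrict A] (Iio ξ).indicator f :=
  ((Lp.memLp f).indicator (measurableSet_Iio (a := ξ))).coeFn_toLp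

theorem norm_projP_apply_le (A : Set ℝ) (ξ : ℝ) (f : L2 A) : ‖projP A ξ f‖ ≤ ‖f‖ := by
  refine Lp.norm_le_norm_of_ae_le ?_
  filter_upwards [projP_apply_ae A ξ f] with x hx
  rw [hx]
  exact norm_indicator_le_norm_self _ _

theorem tendsto_projQ_apply (A : Set ℝ) (r : L2 A) :
    Tendsto (fun ξ => projQ A ξ r) atTop (𝓝 0) := by
  refine tendsto_zero_of_dominated r (fun ξ => (Ici ξ).indicator r) (fun ξ => ?_) (fun ξ x => ?_)
    fun x => ?_
  · rw [projQ, sub_apply, one_apply_eq_self]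
    filter_upwards [Lp.coeFn_sub r (projP A ξ r), projP_apply_ae A ξ r] with x h1 h2
    rw [h1, Pi.sub_apply, h2]
    by_cases hx : x < ξ
    · rw [indicator_of_mem (mem_Iio.2 hx), indicator_of_notMem (by simpa using hx), sub_self]
    · rw [indicator_of_notMem (by simpa using hx), indicator_of_mem (by simpa using hx), sub_zero]
  · exact norm_indicator_le_norm_self _ _
  · refine tendsto_const_nhds.congr' ?_
    filter_upwards [eventually_gt_atTop x] with ξ hξ
    rw [indicator_of_notMem (by simpa using hξ)]

theorem toL2_ae {A : Set ℝ} (hg : MemLp g 2 (volume.restrict A)) :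
    toL2 A g =ᵐ[volume.restrict A] g := by
  rw [toL2, dif_pos hg]
  exact hg.coeFn_toLp

/-- The function `φ` on `(0,ξ)`, extended by zero, as an element of `L²(0,∞)`. -/
noncomputable def truncVec (φ : ℝ → ℂ) (ξ : ℝ) : L2 (Ioi 0) := toL2 (Ioi 0) ((Ioo 0 ξ).indicator φ)

theorem truncVec_ae (hφ : Continuous φ) :
    truncVec φ ξ =ᵐ[volume.restrict (Ioi 0)] (Ioo 0 ξ).indicator φ :=
  toL2_ae (((memLp_indicator_iff_restrict measurableSet_Ioo).2
    (memLp_Ioo_of_continuous hφ)).restrict _)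

theorem integral_mul_truncVec (hφ : Continuous φ) (hξ : 0 ≤ ξ) (ψ : ℝ → ℂ) :
    ∫ x in Ioi 0, ψ x * truncVec φ ξ x = ∫ x in (0 : ℝ)..ξ, ψ x * φ x := by
  rw [intervalIntegral_eq_integral_Ioo hξ, ← inter_eq_self_of_subset_right
    (Ioo_subset_Ioi_self : Ioo (0 : ℝ) ξ ⊆ Ioi 0), ← setIntegral_indicator measurableSet_Ioo]
  refine integral_congr_ae ?_
  filter_upwards [truncVec_ae (ξ := ξ) hφ] with x hx
  rw [hx, indicator_mul_right]

/-- Finite sections: the solutions of the truncated equations converge in `L²(0,∞)`. -/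
theorem tendsto_truncVec_truncSol (hb : ∀ l, |ρ l| ≤ U) (hi : Integrable ρ) (hμ : |μ| * U < 1)
    (hg : Continuous g) (hg2 : MemLp g 2 (volume.restrict (Ioi 0))) :
    Tendsto (fun ξ => truncVec (truncSol ρ μ g ξ) ξ) atTop
      (𝓝 ((fullS ρ μ).inverse (toL2 (Ioi 0) g))) := by
  set r := (fullS ρ μ).inverse (toL2 (Ioi 0) g) with hr
  have hSr : fullS ρ μ r = toL2 (Ioi 0) g :=
    (isInvertible_opS hb hi hμ measurableSet_Ioi).self_apply_inverse _
  have hκ : 0 < 1 - |μ| * U := by linarith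
  have hbound : ∀ ξ, 0 ≤ ξ → ‖truncVec (truncSol ρ μ g ξ) ξ - r‖ ≤
      ‖projQ (Ioi 0) ξ r‖ / (1 - |μ| * U) := by
    intro ξ hξ
    have hsol := isTruncSol_truncSol hb hi hμ hg hξ
    set u := truncVec (truncSol ρ μ g ξ) ξ with hu
    set d := u - r with hd
    set T : L2 (Ioi 0) →L[ℂ] L2 (Ioi 0) := (μ : ℂ) • convolutionOperator ρ (Ioi 0) with hT
    have hS : fullS ρ μ d = d - T d := rfl
    -- On `(0,ξ)` the extended truncated solution satisfies the full equation, so `S d` vanishes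
    -- there.
    have hproj : projP (Ioi 0) ξ (fullS ρ μ d) = 0 := by
      rw [Lp.eq_zero_iff_ae_eq_zero, hd, map_sub, hSr]
      filter_upwards [projP_apply_ae (Ioi 0) ξ (fullS ρ μ u - toL2 (Ioi 0) g),
        Lp.coeFn_sub (fullS ρ μ u) (toL2 (Ioi 0) g), opS_apply_ae (μ := μ) hb hi measurableSet_Ioi u,
        toL2_ae hg2, truncVec_ae (ξ := ξ) hsol.cont, ae_restrict_mem measurableSet_Ioi]
        with x h1 h2 h3 h4 h5 h6
      rw [h1, Pi.zero_apply]
      by_cases hx : x < ξ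
      · rw [indicator_of_mem (mem_Iio.2 hx), h2, Pi.sub_apply, h3, h4, h5,
          indicator_of_mem (show x ∈ Ioo 0 ξ from ⟨h6, hx⟩),
          integral_mul_truncVec hsol.cont hξ, hsol.eqn x]
        ring
      · rw [indicator_of_notMem (by simpa using hx)]
    have hQu : projQ (Ioi 0) ξ u = 0 := by
      rw [projQ, sub_apply, one_apply_eq_self, sub_eq_zero]
      refine Lp.ext ?_
      filter_upwards [projP_apply_ae (Ioi 0) ξ u, truncVec_ae (ξ := ξ) hsol.cont] with x h1 h2
      rw [h1]
      by_cases hx : x < ξ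
      · rw [indicator_of_mem (mem_Iio.2 hx)]
      · rw [indicator_of_notMem (by simpa using hx), h2,
          indicator_of_notMem (fun h => hx h.2)]
    -- Below `ξ` the error equals `T d`, above `ξ` it is `-r`. Since `T` is a strict contraction,
    -- its term is absorbed and the tail of `r` controls the whole error.
    have hdec : d = projP (Ioi 0) ξ (T d) - projQ (Ioi 0) ξ r := by
      have h1 : projQ (Ioi 0) ξ d = - projQ (Ioi 0) ξ r := by rw [hd, map_sub, hQu, zero_sub]
      have h2 : d = projP (Ioi 0) ξ d + projQ (Ioi 0) ξ d := by
        rw [projQ, sub_apply, one_apply_eq_self]; abel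
      rw [hS, map_sub, sub_eq_zero] at hproj
      rw [h1, hproj] at h2
      rw [← sub_eq_add_neg] at h2
      exact h2
    have h1 : ‖T d‖ ≤ |μ| * U * ‖d‖ := by
      rw [hT, smul_apply, norm_smul, Complex.norm_real, Real.norm_eq_abs, mul_assoc]
      exact mul_le_mul_of_nonneg_left ((convolutionOperator ρ _).le_of_opNorm_le
        (convolutionOperator_spec hb hi measurableSet_Ioi).2 d) (abs_nonneg μ)
    have h2 : ‖d‖ ≤ ‖projP (Ioi 0) ξ (T d)‖ + ‖projQ (Ioi 0) ξ r‖ := by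
      conv_lhs => rw [hdec]
      exact norm_sub_le _ _
    have h3 := norm_projP_apply_le (Ioi 0) ξ (T d)
    rw [le_div_iff₀ hκ]
    linarith
  rw [tendsto_iff_norm_sub_tendsto_zero]
  refine tendsto_of_tendsto_of_tendsto_of_le_of_le' (g := fun _ => 0)
    (h := fun ξ => ‖projQ (Ioi 0) ξ r‖ / (1 - |μ| * U))
    tendsto_const_nhds ?_ (Eventually.of_forall fun _ => norm_nonneg _) ?_
  · simpa using ((tendsto_projQ_apply (Ioi 0) r).norm).div_const (1 - |μ| * U)
  · filter_upwards [eventually_ge_atTop 0] with ξ hξ using hbound ξ hξ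

/-! ### Decaying exponentials -/

theorem norm_exp_neg_I_mul (z : ℂ) (x : ℝ) :
    ‖Complex.exp (-(Complex.I * z * x))‖ = Real.exp (z.im * x) := by
  rw [Complex.norm_exp]
  simp

theorem memLp_exp {z : ℂ} (hz : z.im < 0) :
    MemLp (fun x : ℝ => Complex.exp (-(Complex.I * z * x))) 2 (volume.restrict (Ioi 0)) := by
  rw [memLp_two_iff_integrable_sq_norm (Continuous.aestronglyMeasurable (by fun_prop))]
  have := integrableOn_exp_mul_Ioi (a := 2 * z.im) (by linarith) 0
  refine this.congr (ae_of_all _ fun x => ?_)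
  simp only
  rw [norm_exp_neg_I_mul, ← Real.exp_nat_mul]
  congr 1
  push_cast
  ring

/-- The reflection of `σ` on `(0,ξ)`, extended by zero. -/
noncomputable def reflectOn (σ : ℝ → ℂ) (ξ : ℝ) : ℝ → ℂ := (Ioo 0 ξ).indicator fun t => σ (ξ - t)

theorem memLp_reflectOn {σ : ℝ → ℂ} (hσ : Continuous σ) (A : Set ℝ) :
    MemLp (reflectOn σ ξ) 2 (volume.restrict A) :=
  ((memLp_indicator_iff_restrict measurableSet_Ioo).2
    (memLp_Ioo_of_continuous (by fun_prop))).restrict _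

theorem norm_reflectOn_le {σ : ℝ → ℂ} (hσ : Continuous σ)
    (h : MemLp σ 2 (volume.restrict (Ioi 0))) :
    ‖(memLp_reflectOn (ξ := ξ) hσ (Ioi 0)).toLp _‖ ≤ ‖h.toLp σ‖ := by
  rw [Lp.norm_toLp, Lp.norm_toLp]
  refine ENNReal.toReal_mono h.2.ne ?_
  have e : reflectOn σ ξ = (Ioo 0 ξ).indicator σ ∘ fun t => ξ - t := by
    funext t
    by_cases ht : t ∈ Ioo 0 ξ
    · have : ξ - t ∈ Ioo 0 ξ := ⟨by linarith [ht.2], by linarith [ht.1]⟩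
      rw [reflectOn, indicator_of_mem ht, Function.comp_apply, indicator_of_mem this]
    · have : ξ - t ∉ Ioo 0 ξ := fun h => ht ⟨by linarith [h.2], by linarith [h.1]⟩
      rw [reflectOn, indicator_of_notMem ht, Function.comp_apply, indicator_of_notMem this]
  refine (eLpNorm_mono_measure _ Measure.restrict_le_self).trans ?_
  rw [e, eLpNorm_comp_measurePreserving
    (hσ.aestronglyMeasurable.indicator measurableSet_Ioo)
    (Measure.measurePreserving_sub_left volume ξ),
    eLpNorm_indicator_eq_eLpNorm_restrict measurableSet_Ioo]
  exact eLpNorm_mono_measure _ (Measure.restrict_mono Ioo_subset_Ioi_self le_rfl)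

/-- The convolution at `ξ` of a decaying exponential with a family converging in `L²(0,∞)` tends to
zero. -/
theorem tendsto_conv_exp {Φ : ℝ → ℝ → ℂ} (hΦ : ∀ ξ, 0 ≤ ξ → Continuous (Φ ξ)) {r : L2 (Ioi 0)}
    (hr : Tendsto (fun ξ => truncVec (Φ ξ) ξ) atTop (𝓝 r)) {z : ℂ} (hz : z.im < 0) :
    Tendsto (fun ξ : ℝ => ∫ x in (0 : ℝ)..ξ, Complex.exp (-(Complex.I * z * (ξ - x : ℝ))) * Φ ξ x)
      atTop (𝓝 0) := by
  -- The exponential is split as a square `σ²`. One factor is used in Cauchy–Schwarz, where it is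
  -- bounded in `L²` uniformly in `ξ`; the other multiplies the `L²` family and forces it to zero.
  set σ : ℝ → ℂ := fun x => Complex.exp (-(Complex.I * (z / 2) * x)) with hσ
  have hσc : Continuous σ := by fun_prop
  have hz2 : (z / 2).im < 0 := by
    have : (z / 2).im = z.im / 2 := by simp
    rw [this]; linarith
  have hσ2 : MemLp σ 2 (volume.restrict (Ioi 0)) := memLp_exp hz2
  have hσ1 : ∀ ξ t, ‖reflectOn σ ξ t‖ ≤ 1 := fun ξ t => by
    by_cases ht : t ∈ Ioo 0 ξ
    · rw [reflectOn, indicator_of_mem ht, hσ]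
      simp only
      rw [norm_exp_neg_I_mul, Real.exp_le_one_iff]
      nlinarith [ht.2]
    · rw [reflectOn, indicator_of_notMem ht, norm_zero]; exact zero_le_one
  have hmul : ∀ (ξ : ℝ) (f : L2 (Ioi 0)),
      MemLp (fun x => reflectOn σ ξ x * f x) 2 (volume.restrict (Ioi 0)) := fun ξ f => by
    refine (Lp.memLp f).of_le_mul (c := 1)
      ((memLp_reflectOn hσc (Ioi 0)).1.mul (Lp.aestronglyMeasurable f)) (ae_of_all _ fun x => ?_)
    rw [norm_mul]
    exact mul_le_mul_of_nonneg_right (hσ1 ξ x) (norm_nonneg _)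
  have hmulle : ∀ (ξ : ℝ) (f : L2 (Ioi 0)), ‖(hmul ξ f).toLp _‖ ≤ ‖f‖ := fun ξ f => by
    refine Lp.norm_le_norm_of_ae_le ?_
    filter_upwards [(hmul ξ f).coeFn_toLp] with x hx
    rw [hx, norm_mul]
    exact mul_le_of_le_one_left (norm_nonneg _) (hσ1 ξ x)
  have hadd : ∀ (ξ : ℝ) (f : L2 (Ioi 0)),
      ‖(hmul ξ f).toLp _‖ ≤ ‖f - r‖ + ‖(hmul ξ r).toLp _‖ := fun ξ f => by
    have e : (hmul ξ f).toLp _ = (hmul ξ (f - r)).toLp _ + (hmul ξ r).toLp _ := by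
      rw [← MemLp.toLp_add]
      refine MemLp.toLp_congr _ _ ?_
      filter_upwards [Lp.coeFn_sub f r] with x hx
      rw [Pi.add_apply, hx, Pi.sub_apply]
      ring
    rw [e]
    exact (norm_add_le _ _).trans (add_le_add_left (hmulle ξ _) _)
  -- For fixed `x` the reflected exponential decays as `ξ → ∞` and its modulus is at most `1`, so
  -- `|r|` dominates.
  have hzero : Tendsto (fun ξ => (hmul ξ r).toLp _) atTop (𝓝 0) := by
    refine tendsto_zero_of_dominated r (fun ξ x => reflectOn σ ξ x * r x)
      (fun ξ => (hmul ξ r).coeFn_toLp) (fun ξ x => ?_) fun x => ?_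
    · rw [norm_mul]
      exact mul_le_of_le_one_left (norm_nonneg _) (hσ1 ξ x)
    · rw [← zero_mul (r x)]
      refine Tendsto.mul_const _ ?_
      refine squeeze_zero_norm (a := fun ξ => Real.exp ((z / 2).im * (ξ - x))) (fun ξ => ?_) ?_
      · by_cases ht : x ∈ Ioo 0 ξ
        · rw [reflectOn, indicator_of_mem ht, hσ]
          simp only
          rw [norm_exp_neg_I_mul]
        · rw [reflectOn, indicator_of_notMem ht, norm_zero]; positivity
      · refine Real.tendsto_exp_atBot.comp (Tendsto.const_mul_atTop_of_neg hz2 ?_)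
        exact tendsto_atTop_add_const_right _ _ tendsto_id
  refine squeeze_zero_norm' (a := fun ξ => ‖hσ2.toLp σ‖ *
    (‖truncVec (Φ ξ) ξ - r‖ + ‖(hmul ξ r).toLp _‖)) ?_ ?_
  · filter_upwards [eventually_ge_atTop 0] with ξ hξ
    have e : ∫ x in (0 : ℝ)..ξ, Complex.exp (-(Complex.I * z * (ξ - x : ℝ))) * Φ ξ x =
        ∫ x in Ioi 0, reflectOn σ ξ x * (reflectOn σ ξ x * truncVec (Φ ξ) ξ x) := by
      simp only [← mul_assoc]
      rw [integral_mul_truncVec (hΦ ξ hξ) hξ, intervalIntegral_eq_integral_Ioo hξ,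
        intervalIntegral_eq_integral_Ioo hξ]
      refine setIntegral_congr_fun measurableSet_Ioo fun x hx => ?_
      simp only [reflectOn, indicator_of_mem hx, hσ]
      rw [← Complex.exp_add]
      congr 2
      ring
    rw [e]
    refine (norm_integral_mul_le (memLp_reflectOn hσc (Ioi 0)) (hmul ξ _)).trans ?_
    exact mul_le_mul (norm_reflectOn_le hσc hσ2) (hadd ξ _) (norm_nonneg _) (norm_nonneg _)
  · have h1 := (tendsto_iff_norm_sub_tendsto_zero.1 hr).add hzero.norm
    simpa using h1.const_mul ‖hσ2.toLp σ‖

theorem tendsto_integral_exp {Φ : ℝ → ℝ → ℂ} (hΦ : ∀ ξ, 0 ≤ ξ → Continuous (Φ ξ)) {r : L2 (Ioi 0)}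
    (hr : Tendsto (fun ξ => truncVec (Φ ξ) ξ) atTop (𝓝 r)) {z : ℂ} (hz : z.im < 0) :
    Tendsto (fun ξ : ℝ => ∫ x in (0 : ℝ)..ξ, Complex.exp (-(Complex.I * z * x)) * Φ ξ x)
      atTop (𝓝 (∫ x in Ioi (0 : ℝ), Complex.exp (-(Complex.I * z * x)) * r x)) := by
  have he := memLp_exp hz
  have hint : ∀ f : L2 (Ioi 0), Integrable (fun x : ℝ => Complex.exp (-(Complex.I * z * x)) * f x)
      (volume.restrict (Ioi 0)) := fun f => he.integrable_mul (Lp.memLp f)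
  rw [tendsto_iff_norm_sub_tendsto_zero]
  refine squeeze_zero_norm' (a := fun ξ => ‖he.toLp _‖ * ‖truncVec (Φ ξ) ξ - r‖) ?_ ?_
  · filter_upwards [eventually_ge_atTop 0] with ξ hξ
    rw [norm_norm, ← integral_mul_truncVec (hΦ ξ hξ) hξ,
      ← integral_sub (hint _) (hint _)]
    have h := norm_integral_mul_le he (Lp.memLp (truncVec (Φ ξ) ξ - r))
    rw [Lp.toLp_coeFn] at h
    refine le_of_eq_of_le (congrArg norm (integral_congr_ae ?_)) h
    filter_upwards [Lp.coeFn_sub (truncVec (Φ ξ) ξ) r] with x hx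
    rw [hx, Pi.sub_apply]
    ring
  · simpa using (tendsto_iff_norm_sub_tendsto_zero.1 hr).const_mul ‖he.toLp _‖

end
/-! ### The limits -/

section
variable {ρ : ℝ → ℝ} {U μ : ℝ} {ξ : ℝ}

theorem continuous_qFun (hi : Integrable ρ) : Continuous (qFun ρ μ) :=
  (continuous_massM hi).sub continuous_const

/-- Since `h` has total integral `1/2`, the constant `(1 - μ)/2` is the limit of `M` at infinity, so
`q` is the decaying part of `M`. -/
theorem qFun_eq_tailIntegral (hi : Integrable ρ)
    (hhalf : Tendsto (fun X : ℝ => ∫ x in (0 : ℝ)..X, kernel ρ x) atTop (𝓝 (1 / 2))) (x : ℝ) :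
    qFun ρ μ x = (μ : ℂ) * tailIntegral ρ x := by
  have hk := continuous_kernel hi
  have h : Tendsto (fun X : ℝ => ∫ t in x..X, kernel ρ t) atTop
      (𝓝 (1 / 2 - ∫ t in (0 : ℝ)..x, kernel ρ t)) := by
    refine (hhalf.sub_const _).congr fun X => ?_
    exact intervalIntegral.integral_interval_sub_left (hk.intervalIntegrable _ _)
      (hk.intervalIntegrable _ _)
  rw [tailIntegral, h.limUnder_eq, qFun, massM]
  ring

theorem memLp_qFun (hi : Integrable ρ)
    (hhalf : Tendsto (fun X : ℝ => ∫ x in (0 : ℝ)..X, kernel ρ x) atTop (𝓝 (1 / 2)))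
    (htail : MemLp (tailIntegral ρ) 2 (volume.restrict (Ioi 0))) :
    MemLp (qFun ρ μ) 2 (volume.restrict (Ioi 0)) := by
  rw [funext (qFun_eq_tailIntegral hi hhalf)]
  exact htail.const_mul _

/-- If `μ = 1` then `M = q` lies in `L²`, so the solutions with right-hand side `M` are bounded in
`L²` uniformly in `ξ` and their integrals grow at most like `√ξ`. Those integrals equal `ξ / 2`, a
contradiction. This justifies the division by `1 - μ` in `G`. -/
theorem one_sub_ne_zero_of_memLp_qFun (hb : ∀ l, |ρ l| ≤ U) (heven : ∀ l, ρ (-l) = ρ l)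
    (hi : Integrable ρ) (hμ : |μ| * U < 1)
    (hq : MemLp (qFun ρ μ) 2 (volume.restrict (Ioi 0))) : (1 : ℂ) - μ ≠ 0 := by
  intro h0
  have hκ : 0 < 1 - |μ| * U := by linarith
  have hqM : qFun ρ μ = massM ρ μ := by funext x; rw [qFun, h0]; simp
  set B := ‖hq.toLp _‖ / (1 - |μ| * U) with hB
  have key : ∀ ξ, 0 ≤ ξ → ξ / 2 ≤ √ξ * B := by
    intro ξ hξ
    have hsol := isTruncSol_truncSol hb hi hμ (continuous_massM (μ := μ) hi) hξ
    have h1 := integral_truncSol_mass (continuous_scaledKernel hi) (scaledKernel_neg heven)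
      (hasAprioriBound_scaledKernel hb hi hμ) (massM_eq ρ μ) hξ hsol
    set φ := truncSol ρ μ (massM ρ μ) ξ
    have hφ2 := memLp_Ioo_of_continuous (ξ := ξ) hsol.cont
    have hM2 := memLp_Ioo_of_continuous (ξ := ξ) (continuous_massM (μ := μ) hi)
    have hone := memLp_Ioo_of_continuous (ξ := ξ) (continuous_const (y := (1 : ℂ)))
    have h2 := norm_integral_mul_le hone hφ2
    simp only [one_mul] at h2
    rw [← intervalIntegral_eq_integral_Ioo hξ, h1] at h2
    have h3 := norm_toLp_Ioo_le hξ hone zero_le_one (fun _ _ => by simp)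
    have h4 := le_norm_opS_apply (μ := μ) hb hi measurableSet_Ioo (hφ2.toLp φ)
    rw [hsol.opS_toLp hb hi hξ hφ2 hM2] at h4
    have h5 : ‖hM2.toLp _‖ ≤ ‖hq.toLp _‖ := by
      rw [Lp.norm_toLp, Lp.norm_toLp, ← hqM]
      exact ENNReal.toReal_mono hq.2.ne
        (eLpNorm_mono_measure _ (Measure.restrict_mono Ioo_subset_Ioi_self le_rfl))
    have h6 : ‖hφ2.toLp φ‖ ≤ B := by
      rw [hB, le_div_iff₀ hκ]
      linarith
    have h7 : ‖((ξ : ℂ) / 2)‖ = ξ / 2 := by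
      rw [norm_div, Complex.norm_real, Real.norm_of_nonneg hξ]; simp
    rw [h7] at h2
    rw [mul_one] at h3
    exact h2.trans (mul_le_mul h3 h6 (norm_nonneg _) (Real.sqrt_nonneg _))
  have hB0 : 0 ≤ B := by positivity
  -- At `ξ = (2B + 1)²` the inequality would read `(2B + 1)² / 2 ≤ (2B + 1) B`, that is `2B + 1 ≤
  -- 2B`.
  have h := key ((2 * B + 1) ^ 2) (by positivity)
  rw [Real.sqrt_sq (by positivity)] at h
  nlinarith

/-- Subtracting `q` and its reflection from `S_ξ 1 = M(x) + M(ξ - x)` leaves the constant `1 - μ`;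
uniqueness for the truncated equation concludes. -/
theorem truncSol_one_decomposition (hb : ∀ l, |ρ l| ≤ U) (heven : ∀ l, ρ (-l) = ρ l)
    (hi : Integrable ρ) (hμ : |μ| * U < 1) (hξ : 0 ≤ ξ) (x : ℝ) :
    (1 - (μ : ℂ)) * truncSol ρ μ (fun _ => 1) ξ x =
      1 - truncSol ρ μ (qFun ρ μ) ξ x - truncSol ρ μ (qFun ρ μ) ξ (ξ - x) := by
  have hk : Continuous (scaledKernel ρ μ) := continuous_scaledKernel hi
  have hev := scaledKernel_neg (μ := μ) heven
  have s1 := (isTruncSol_truncSol hb hi hμ (continuous_const (y := (1 : ℂ))) hξ).const_mul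
    (1 - (μ : ℂ))
  have sq := isTruncSol_truncSol hb hi hμ (continuous_qFun (μ := μ) hi) hξ
  have s2 := ((isTruncSol_one (ξ := ξ) hk hev (massM_eq ρ μ)).sub hk sq).sub hk (sq.reflect hev)
  have e : (fun x => massM ρ μ x + massM ρ μ (ξ - x) - qFun ρ μ x - qFun ρ μ (ξ - x)) =
      fun _ => (1 - (μ : ℂ)) * 1 := by
    funext x
    simp only [qFun]
    ring
  rw [e] at s2
  exact congrFun (s1.unique hk (hasAprioriBound_scaledKernel hb hi hμ) hξ s2) x

/-! ### Limits of the exponential integrals. -/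

theorem integral_exp_neg_I_mul (z : ℂ) (ξ : ℝ) :
    Complex.I * z * ∫ x in (0 : ℝ)..ξ, Complex.exp (-(Complex.I * z * x)) =
      1 - Complex.exp (-(Complex.I * z * ξ)) := by
  have hd : ∀ y ∈ uIcc 0 ξ, HasDerivAt (fun y : ℝ => -Complex.exp (-(Complex.I * z * y)))
      (Complex.I * z * Complex.exp (-(Complex.I * z * y))) y := fun y _ => by
    have := ((Complex.ofRealCLM.hasDerivAt (x := y)).const_mul (Complex.I * z)).neg.cexp.neg
    refine this.congr_deriv ?_
    simp
    ring
  have := intervalIntegral.integral_eq_sub_of_hasDerivAt hd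
    (Continuous.intervalIntegrable (by fun_prop) _ _)
  rw [intervalIntegral.integral_const_mul] at this
  rw [this]
  simp
  ring

theorem tendsto_integral_exp_truncSol_one (hb : ∀ l, |ρ l| ≤ U) (heven : ∀ l, ρ (-l) = ρ l)
    (hi : Integrable ρ) (hμ : |μ| * U < 1)
    (hq : MemLp (qFun ρ μ) 2 (volume.restrict (Ioi 0))) {z : ℂ} (hz : z.im < 0) :
    Tendsto (fun ξ : ℝ => Complex.I * z *
      ∫ x in (0 : ℝ)..ξ, Complex.exp (-(Complex.I * z * x)) * truncSol ρ μ (fun _ => 1) ξ x)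
      atTop (𝓝 (limitG ρ μ z)) := by
  have hne := one_sub_ne_zero_of_memLp_qFun hb heven hi hμ hq
  have hqc : Continuous (qFun ρ μ) := continuous_qFun hi
  have hΦ : ∀ ξ, 0 ≤ ξ → Continuous (truncSol ρ μ (qFun ρ μ) ξ) := fun ξ hξ =>
    (isTruncSol_truncSol hb hi hμ hqc hξ).cont
  have hlim := tendsto_truncVec_truncSol hb hi hμ hqc hq
  have t1 : Tendsto (fun ξ : ℝ => 1 - Complex.exp (-(Complex.I * z * ξ))) atTop (𝓝 (1 - 0)) := by
    refine tendsto_const_nhds.sub ?_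
    rw [tendsto_zero_iff_norm_tendsto_zero]
    simp only [norm_exp_neg_I_mul]
    exact Real.tendsto_exp_atBot.comp (Tendsto.const_mul_atTop_of_neg hz tendsto_id)
  have t2 := (tendsto_integral_exp hΦ hlim hz).const_mul (Complex.I * z)
  have t3 := (tendsto_conv_exp hΦ hlim hz).const_mul (Complex.I * z)
  have t := ((t1.sub t2).sub t3).const_mul (1 / (1 - (μ : ℂ)))
  rw [mul_zero, sub_zero, sub_zero] at t
  refine t.congr' ?_
  filter_upwards [eventually_ge_atTop 0] with ξ hξ
  have hc := hΦ ξ hξ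
  -- The substitution `x ↦ ξ - x` turns the reflected term into the convolution at `ξ` whose limit
  -- is zero.
  have hrefl := intervalIntegral.integral_comp_sub_left (a := 0) (b := ξ)
    (fun x => Complex.exp (-(Complex.I * z * x)) * truncSol ρ μ (qFun ρ μ) ξ (ξ - x)) ξ
  simp only [sub_self, sub_zero, sub_sub_cancel] at hrefl
  rw [← integral_exp_neg_I_mul, hrefl, ← mul_sub, ← mul_sub, mul_left_comm,
    ← intervalIntegral.integral_sub (Continuous.intervalIntegrable (by fun_prop) _ _)
      (Continuous.intervalIntegrable (by fun_prop) _ _),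
    ← intervalIntegral.integral_sub (Continuous.intervalIntegrable (by fun_prop) _ _)
      (Continuous.intervalIntegrable (by fun_prop) _ _), ← intervalIntegral.integral_const_mul]
  refine congrArg _ (intervalIntegral.integral_congr fun x _ => ?_)
  have := truncSol_one_decomposition hb heven hi hμ hξ x
  field_simp
  linear_combination -this

/-- The solution with right-hand side `1` is invariant under `x ↦ ξ - x`, and this substitution
turns `e^{-izξ} e^{izx}` into `e^{-izx}`. The lower half plane limit thus involves only a decaying
exponential. -/
theorem canonicalSolution_entry_reflected (hb : ∀ l, |ρ l| ≤ U) (heven : ∀ l, ρ (-l) = ρ l)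
    (hi : Integrable ρ) (hμ : |μ| * U < 1) {W : ℝ → ℂ → Matrix (Fin 2) (Fin 2) ℂ}
    (hW : IsCanonicalSolution ρ μ W) (z : ℂ) (hξ : 0 ≤ ξ) :
    Complex.exp (-(Complex.I * z * ξ)) * W ξ z 0 1 = Complex.I * z *
      ∫ x in (0 : ℝ)..ξ, Complex.exp (-(Complex.I * z * x)) * truncSol ρ μ (fun _ => 1) ξ x := by
  have s1 := isTruncSol_truncSol hb hi hμ (continuous_const (y := (1 : ℂ))) hξ
  have hs := (s1.reflect (scaledKernel_neg heven)).unique (continuous_scaledKernel hi)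
    (hasAprioriBound_scaledKernel hb hi hμ) hξ s1
  have hrefl := intervalIntegral.integral_comp_sub_left (a := 0) (b := ξ)
    (fun x => Complex.exp (Complex.I * z * x) * truncSol ρ μ (fun _ => 1) ξ x) ξ
  rw [sub_self, sub_zero] at hrefl
  rw [canonicalSolution_entry hb heven hi hμ hW z hξ, ← hrefl, mul_left_comm,
    ← intervalIntegral.integral_const_mul]
  refine congrArg _ (intervalIntegral.integral_congr fun x _ => ?_)
  rw [← congrFun hs x, ← mul_assoc, ← Complex.exp_add]
  congr 2
  push_cast
  ring

/-- Evenness of `ρ` makes `h` real, so uniqueness forces the solution with real right-hand side to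
be real. This permits passage between the half planes by conjugation. -/
theorem conj_truncSol_one (hb : ∀ l, |ρ l| ≤ U) (heven : ∀ l, ρ (-l) = ρ l)
    (hi : Integrable ρ) (hμ : |μ| * U < 1) (hξ : 0 ≤ ξ) (x : ℝ) :
    (starRingEnd ℂ) (truncSol ρ μ (fun _ => 1) ξ x) = truncSol ρ μ (fun _ => 1) ξ x := by
  have s1 := isTruncSol_truncSol hb hi hμ (continuous_const (y := (1 : ℂ))) hξ
  have s2 := s1.conj (conj_scaledKernel heven)
  simp only [map_one] at s2
  exact congrFun (s2.unique (continuous_scaledKernel hi)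
    (hasAprioriBound_scaledKernel hb hi hμ) hξ s1) x

/-- The limit of `e^{-izξ} w₁₂(ξ,z)` in the lower half plane. -/
theorem tendsto_entry_lower (hb : ∀ l, |ρ l| ≤ U) (heven : ∀ l, ρ (-l) = ρ l)
    (hi : Integrable ρ) (hμ : |μ| * U < 1) {W : ℝ → ℂ → Matrix (Fin 2) (Fin 2) ℂ}
    (hW : IsCanonicalSolution ρ μ W)
    (hq : MemLp (qFun ρ μ) 2 (volume.restrict (Ioi 0))) {z : ℂ} (hz : z.im < 0) :
    Tendsto (fun ξ : ℝ => Complex.exp (-(Complex.I * z * ξ)) * W ξ z 0 1) atTop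
      (𝓝 (limitG ρ μ z)) := by
  refine (tendsto_integral_exp_truncSol_one hb heven hi hμ hq hz).congr' ?_
  filter_upwards [eventually_ge_atTop 0] with ξ hξ
  exact (canonicalSolution_entry_reflected hb heven hi hμ hW z hξ).symm

/-- The limit of `w₁₂(ξ,z)` in the upper half plane. -/
theorem tendsto_entry_upper (hb : ∀ l, |ρ l| ≤ U) (heven : ∀ l, ρ (-l) = ρ l)
    (hi : Integrable ρ) (hμ : |μ| * U < 1) {W : ℝ → ℂ → Matrix (Fin 2) (Fin 2) ℂ}
    (hW : IsCanonicalSolution ρ μ W)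
    (hq : MemLp (qFun ρ μ) 2 (volume.restrict (Ioi 0))) {z : ℂ} (hz : 0 < z.im) :
    Tendsto (fun ξ : ℝ => W ξ z 0 1) atTop
      (𝓝 (-(starRingEnd ℂ) (limitG ρ μ ((starRingEnd ℂ) z)))) := by
  -- The limit is taken at the conjugate point, which lies in the lower half plane; conjugating the
  -- prefactor `i z̄` gives `-iz`, the source of the minus sign.
  have h := tendsto_integral_exp_truncSol_one hb heven hi hμ hq (z := (starRingEnd ℂ) z)
    (by simpa using hz)
  refine (((Complex.continuous_conj.tendsto _).comp h).neg).congr' ?_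
  filter_upwards [eventually_ge_atTop 0] with ξ hξ
  rw [canonicalSolution_entry hb heven hi hμ hW z hξ, Function.comp_apply, map_mul, map_mul,
    Complex.conj_I, Complex.conj_conj, ← intervalIntegral.intervalIntegral_conj, ← neg_mul,
    ← neg_mul, neg_neg]
  refine congrArg _ (intervalIntegral.integral_congr fun x _ => ?_)
  rw [map_mul, conj_truncSol_one hb heven hi hμ hξ, ← Complex.exp_conj]
  simp

end
end WienerHopf

theorem proposition3p1
    (ρ : ℝ → ℝ) (U μ : ℝ)
    (hU : 0 < U) (hbound : ∀ l, |ρ l| ≤ U)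
    (heven : ∀ l, ρ (-l) = ρ l) (hint : Integrable ρ)
    (hμ : -(1 / U) < μ ∧ μ < 1 / U)
    (hhalf : Tendsto (fun X : ℝ => ∫ x in (0 : ℝ)..X, kernel ρ x) atTop (𝓝 (1 / 2)))
    (htail : MemLp (tailIntegral ρ) 2 (volume.restrict (Ioi 0)))
    (W : ℝ → ℂ → Matrix (Fin 2) (Fin 2) ℂ) (hW : IsCanonicalSolution ρ μ W)
    (hfail :
      (¬ ∀ z : ℂ, z.im < 0 →
        Tendsto (fun ξ : ℝ => Complex.exp (-(Complex.I * z * ξ)) * W ξ z 0 1) atTop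
          (𝓝 (limitG ρ μ z))) ∨
      (¬ ∀ z : ℂ, 0 < z.im →
        Tendsto (fun ξ : ℝ => W ξ z 0 1) atTop
          (𝓝 (-(starRingEnd ℂ) (limitG ρ μ ((starRingEnd ℂ) z)))))) :
    ¬ AdmitsTriangularFactorization (fullS ρ μ) := by
  have hμU : |μ| * U < 1 := by
    rw [← lt_div_iff₀ hU, abs_lt]
    exact hμ
  have hq := memLp_qFun (μ := μ) hint hhalf htail
  -- Both relations hold, so the alternative in `hfail` is impossible.
  refine absurd hfail ?_
  rw [not_or, not_not, not_not]
  exact ⟨fun z hz => tendsto_entry_lower hbound heven hint hμU hW hq hz,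
    fun z hz => tendsto_entry_upper hbound heven hint hμU hW hq hz⟩
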